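/- All logarithms are to base 2, and the length of a directed path is its number of edges. A DAG $G=(V,E)$ is \emph{$(e,d)$-depth-robust} (resp. \emph{$(e,d)$-edge-depth-robust}) if for every set $S\subseteq V$ (resp. $S\subseteq E$) with $|S|\le e$ the graph $G-S$ contains a directed path of length at least $d$. (1) There are constants $\delta, C$ and a family of DAGs $\{G_n\}_{n\ge 1}$ such that, with $N=2^n$, the graph $G_n$ has maximum indegree at most $\delta$, has at most $C N$ nodes, and for every integer $s$ with $1\le s\le \log n$ is $$\left(\frac{sN}{2n},\ \frac{N}{\sum_{j=0}^{s}\binom{n}{j}}\right)\text{-edge-depth-robust, and also depth-robust with the same parameters.}$$ (2) There are constants $\delta$, $c>0$, $C$ and a family of DAGs $\{G'_n\}_{n\ge 1}$ such that $G'_n$ has maximum indegree at most $\delta$, its number of nodes $N'$ satisfies $c\, n2^n\le N'\le C\, n2^n$, and $G'_n$ is $$\left(\frac{N'\log\log N'}{\log N'},\ \frac{N'}{(\log N')^{1+\log\log N'}}\right)\text{-depth-robust.}$$ -/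

import Mathlib

namespace DepthRobust

/-- A digraph is acyclic (a DAG): no vertex reaches itself by a nonempty directed walk. -/
def IsAcyclic {V : Type*} (G : Digraph V) : Prop :=
  ∀ v : V, ¬ Relation.TransGen G.Adj v v

/-- Every vertex has at most `δ` incoming edges. -/
def IndegreeLE {V : Type*} (G : Digraph V) (δ : ℕ) : Prop :=
  ∀ v : V, {u : V | G.Adj u v}.encard ≤ δ

/-- `p` is a directed path with `k` edges (and `k + 1` pairwise distinct vertices). -/
def IsPath {V : Type*} (G : Digraph V) (k : ℕ) (p : Fin (k + 1) → V) : Prop :=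
  Function.Injective p ∧ ∀ i : Fin k, G.Adj (p i.castSucc) (p i.succ)

/-- `G` contains a directed path of length (number of edges) at least the real number `d`. -/
def ContainsPath {V : Type*} (G : Digraph V) (d : ℝ) : Prop :=
  ∃ k : ℕ, d ≤ k ∧ ∃ p : Fin (k + 1) → V, IsPath G k p

/-- `G - S` for a set `S` of nodes. -/
def deleteNodes {V : Type*} (G : Digraph V) (S : Finset V) : Digraph {v : V // v ∉ S} where
  Adj u v := G.Adj u v

/-- `G - S` for a set `S` of edges. -/
def deleteEdges {V : Type*} (G : Digraph V) (S : Finset (V × V)) : Digraph V where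
  Adj u v := G.Adj u v ∧ (u, v) ∉ S

/-- `(e, d)`-depth-robustness: after the deletion of any at most `e` nodes there is still a
directed path of length `d`. -/
def IsDepthRobust {V : Type*} (G : Digraph V) (e d : ℝ) : Prop :=
  ∀ S : Finset V, (S.card : ℝ) ≤ e → ContainsPath (deleteNodes G S) d

/-- `(e, d)`-edge-depth-robustness: after the deletion of any at most `e` edges there is still a
directed path of length `d`. -/
def IsEdgeDepthRobust {V : Type*} (G : Digraph V) (e d : ℝ) : Prop :=
  ∀ S : Finset (V × V), (∀ a ∈ S, G.Adj a.1 a.2) → (S.card : ℝ) ≤ e →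
    ContainsPath (deleteEdges G S) d

end DepthRobust

/-! Edge-robustness follows from node-robustness, since a set of edges can be traded for its set of
heads. A DAG without paths of length `d` carries labels below `d` that increase along edges, so
everything is proved about labels and paths are never built.

The graph is a sparse substitute for a transitive tournament on ordered leaves, written in base `2 ^
g` with `h` digits. For leaves `x < y` let `j` be the highest level at which their digits differ.
The edge from `x` to `y` is replaced by a route from the exit hub of `x` through the out-connector
of its block at level `j` to the in-connector of the sibling block containing `y` and on to the
entry hub of `y`. Connectors have linear size and bounded degree (`exists_connector`, built
recursively from random-permutation expanders), so there are about `h` vertices per leaf.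

Deleting `S` spoils at most `12 * |S|` pairs (leaf, level); where level `j` is good for both leaves,
the leaf label of `x` is below that of `y` (`Layout.exists_leaf_label`). By Markov's inequality half
of the leaves have at most `s` bad levels. Attach to such a leaf its bad levels with its digits
there. Two leaves with equal data agree on every level bad for either, so they part at a good level
and have distinct labels. Hence half of the leaves number at most `d + 1` times the number of
possible data, and a larger leaf set forces a long path (`Layout.containsPath`).

For (1) there are of order `2 ^ n / n` leaves in base 2. For (2) there are `2 ^ n` leaves and a
large constant `g`, which reduces the vertices, and hence the deletions, per leaf. Small `n` are
served by tournaments. -/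

namespace DepthRobust

/-! ### Edge deletions versus node deletions; labels in place of paths. -/

section Basic

variable {V : Type*}

/-- Deleting the heads of the given edges is at least as destructive as deleting the edges. -/
theorem IsDepthRobust.isEdgeDepthRobust [DecidableEq V] {G : Digraph V} {e d : ℝ}
    (h : IsDepthRobust G e d) : IsEdgeDepthRobust G e d := by
  intro S _ hS
  obtain ⟨k, hk, p, hp, hadj⟩ := h (S.image Prod.snd)
    (le_trans (by exact_mod_cast Finset.card_image_le) hS)
  refine ⟨k, hk, fun i => (p i).1, fun i j hij => hp (Subtype.ext hij), fun i => ⟨hadj i, ?_⟩⟩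
  intro hmem
  exact (p i.succ).2 (Finset.mem_image.2 ⟨_, hmem, rfl⟩)

theorem isAcyclic_of_strictMono {β : Type*} [Preorder β] {G : Digraph V} (f : V → β)
    (hf : ∀ u v, G.Adj u v → f u < f v) : IsAcyclic G := by
  have key : ∀ u v, Relation.TransGen G.Adj u v → f u < f v := by
    intro u v huv
    induction huv with
    | single h => exact hf _ _ h
    | tail _ h ih => exact ih.trans (hf _ _ h)
  exact fun v hv => lt_irrefl _ (key v v hv)

theorem IsAcyclic.deleteNodes {G : Digraph V} (hG : IsAcyclic G) (S : Finset V) :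
    IsAcyclic (deleteNodes G S) := by
  intro v hv
  exact hG v.1 (Relation.TransGen.lift Subtype.val (fun _ _ h => h) _ _ hv)

theorem IsPath.transGen {G : Digraph V} {k : ℕ} {p : Fin (k + 1) → V} (hp : IsPath G k p)
    (i : Fin (k + 1)) : Relation.ReflTransGen G.Adj (p i) (p (Fin.last k)) := by
  induction i using Fin.reverseInduction with
  | last => exact .refl
  | cast i ih => exact .head (hp.2 i) ih

theorem IsPath.snoc {G : Digraph V} (hG : IsAcyclic G) {k : ℕ} {p : Fin (k + 1) → V}
    (hp : IsPath G k p) {v : V} (hv : G.Adj (p (Fin.last k)) v) :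
    IsPath G (k + 1) (Fin.snoc (α := fun _ => V) p v) := by
  refine ⟨?_, fun i => ?_⟩
  · rw [Fin.snoc_injective_iff]
    refine ⟨hp.1, ?_⟩
    rintro ⟨i, rfl⟩
    exact hG _ (Relation.TransGen.tail' (hp.transGen i) hv)
  · induction i using Fin.lastCases with
    | last => simpa using hv
    | cast i =>
      rw [← Fin.castSucc_succ]
      simpa only [Fin.snoc_castSucc] using hp.2 i

/-- In a DAG without directed paths of length `d`, the vertices can be labelled by natural numbers
below `d` that strictly increase along edges. -/
theorem exists_label {G : Digraph V} (hG : IsAcyclic G) {d : ℕ}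
    (hd : ¬ ContainsPath G d) :
    ∃ l : V → ℕ, (∀ v, l v < d) ∧ ∀ u v, G.Adj u v → l u < l v := by
  classical
  let P : V → ℕ → Prop := fun v k => ∃ p : Fin (k + 1) → V, IsPath G k p ∧ p (Fin.last k) = v
  have hlt : ∀ v k, P v k → k < d := by
    rintro v k ⟨p, hp, -⟩
    by_contra hk
    exact hd ⟨k, by exact_mod_cast not_lt.1 hk, p, hp⟩
  have h0 : ∀ v, P v 0 := fun v =>
    ⟨fun _ => v, ⟨fun i j _ => Subsingleton.elim (α := Fin 1) i j, fun i => i.elim0⟩, rfl⟩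
  have hspec : ∀ v, P v (Nat.findGreatest (P v) d) := fun v =>
    Nat.findGreatest_spec (P := P v) (Nat.zero_le d) (h0 v)
  -- The label of `v` is the length of a longest path ending at `v`.
  refine ⟨fun v => Nat.findGreatest (P v) d, fun v => hlt v _ (hspec v), fun u v huv => ?_⟩
  obtain ⟨p, hp, hlast⟩ := hspec u
  have hPv : P v (Nat.findGreatest (P u) d + 1) :=
    ⟨_, hp.snoc hG (by rw [hlast]; exact huv), by simp⟩
  exact Nat.lt_of_succ_le (Nat.le_findGreatest (hlt _ _ hPv).le hPv)

end Basic

/-! ### Transitive tournaments, and thresholds separating two families of labels. -/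

/-- The transitive tournament on `Fin m`. -/
def tournament (m : ℕ) : Digraph (Fin m) where
  Adj u v := u < v

theorem tournament_isAcyclic (m : ℕ) : IsAcyclic (tournament m) :=
  isAcyclic_of_strictMono id fun _ _ h => h

theorem tournament_indegreeLE (m : ℕ) : IndegreeLE (tournament m) m := by
  intro v
  calc _ ≤ (Set.univ : Set (Fin m)).encard := Set.encard_le_encard (Set.subset_univ _)
    _ = m := by simp

/-- The surviving vertices, in increasing order, form a single path. -/
theorem tournament_isDepthRobust {m : ℕ} {e d : ℝ} (h : e + d + 1 ≤ m) (hd : 0 ≤ d) :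
    IsDepthRobust (tournament m) e d := by
  intro S hS
  have hcard : (Sᶜ.card : ℝ) = m - S.card := by
    rw [Finset.card_compl, Fintype.card_fin, Nat.cast_sub (by simpa using S.card_le_univ)]
  have hpos : (0 : ℝ) < Sᶜ.card := by linarith
  obtain ⟨k, hk⟩ : ∃ k, Sᶜ.card = k + 1 :=
    Nat.exists_eq_succ_of_ne_zero (by exact_mod_cast hpos.ne')
  refine ⟨k, ?_, fun i => ⟨Sᶜ.orderEmbOfFin hk i,
    Finset.mem_compl.1 (Finset.orderEmbOfFin_mem _ _ _)⟩, ?_, ?_⟩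
  · rw [hk] at hcard
    push_cast at hcard
    linarith
  · intro i j hij
    simpa using hij
  · intro i
    exact (Sᶜ.orderEmbOfFin hk).strictMono Fin.castSucc_lt_succ

/-- If large sets of alive inputs and alive outputs always contain a pair with increasing labels,
then some threshold separates all but few inputs from all but few outputs. -/
theorem exists_threshold {ι : Type*} [Fintype ι] [DecidableEq ι] (κ k d : ℕ)
    (alive alive' : ι → Prop) [DecidablePred alive] [DecidablePred alive'] (f g : ι → ℕ)
    (hf : ∀ x, alive x → f x < d)
    (h : ∀ X Y : Finset ι, (∀ x ∈ X, alive x) → (∀ y ∈ Y, alive' y) →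
      k < κ * X.card → k < κ * Y.card → ∃ x ∈ X, ∃ y ∈ Y, f x < g y) :
    ∃ t ≤ d, κ * (Finset.univ.filter fun x => alive x ∧ t ≤ f x).card ≤ k ∧
      κ * (Finset.univ.filter fun y => alive' y ∧ g y < t).card ≤ k := by
  classical
  let P : ℕ → Prop := fun t => κ * (Finset.univ.filter fun x => alive x ∧ t ≤ f x).card ≤ k
  have hP : P d := by
    have : (Finset.univ.filter fun x => alive x ∧ d ≤ f x) = ∅ :=
      Finset.filter_eq_empty_iff.2 fun x _ hx => absurd (hf x hx.1) (not_lt.2 hx.2)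
    simp [P, this]
  have hex : ∃ t, P t := ⟨d, hP⟩
  -- The threshold `t` is the least one with few inputs at or above it. If also many outputs lay
  -- below `t`, minimality at `t - 1` would give a pair with `t - 1 ≤ f x < g y < t`.
  refine ⟨Nat.find hex, Nat.find_min' hex hP, Nat.find_spec hex, ?_⟩
  by_contra hcon
  rcases Nat.eq_zero_or_pos (Nat.find hex) with h0 | hpos
  · rw [h0] at hcon
    simp at hcon
  · have hmin := Nat.find_min hex (Nat.sub_lt hpos one_pos)
    obtain ⟨x, hx, y, hy, hxy⟩ := h _ _ (by simp +contextual) (by simp +contextual)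
      (not_le.1 hmin) (not_le.1 hcon)
    simp only [Finset.mem_filter, Finset.mem_univ, true_and] at hx hy
    omega

/-! ### Expanders from random permutations. -/

section Permutations

variable {m : ℕ}

/-- Composing with a permutation that carries `W` to `W'` injects one family into the other. -/
theorem card_perm_map_eq (X W W' : Finset (Fin m)) (h : W.card = W'.card) :
    (Finset.univ.filter fun π : Equiv.Perm (Fin m) => X.map π.toEmbedding = W).card ≤
      (Finset.univ.filter fun π : Equiv.Perm (Fin m) => X.map π.toEmbedding = W').card := by
  obtain ⟨σ, hσ⟩ : ∃ σ : Equiv.Perm (Fin m), W.map σ.toEmbedding = W' := by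
    let e : {x // x ∈ W} ≃ {x // x ∈ W'} := Finset.equivOfCardEq h
    refine ⟨e.extendSubtype, Finset.eq_of_subset_of_card_le ?_ (by simp [h])⟩
    intro y hy
    obtain ⟨x, hx, rfl⟩ := Finset.mem_map.1 hy
    exact e.extendSubtype_mem x hx
  refine Finset.card_le_card_of_injOn (fun π => π.trans σ) ?_ ?_
  · intro π hπ
    simp only [Finset.coe_filter, Finset.mem_univ, true_and, Set.mem_ofPred_eq] at hπ ⊢
    rw [← hσ, ← hπ, Finset.map_map]
    rfl
  · intro π _ π' _ hππ
    refine Equiv.ext fun x => ?_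
    have := congrArg (fun τ : Equiv.Perm (Fin m) => τ x) hππ
    simpa using this

/-- The number of permutations mapping `X` into `Z`, multiplied out. -/
theorem card_perm_map_subset (X Z : Finset (Fin m)) :
    (Finset.univ.filter fun π : Equiv.Perm (Fin m) => X.map π.toEmbedding ⊆ Z).card *
      m.choose X.card = m.factorial * Z.card.choose X.card := by
  classical
  set c := (Finset.univ.filter fun π : Equiv.Perm (Fin m) => X.map π.toEmbedding = X).card with hc
  have hfib : ∀ W : Finset (Fin m), W.card = X.card →
      (Finset.univ.filter fun π : Equiv.Perm (Fin m) => X.map π.toEmbedding = W).card = c :=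
    fun W hW => le_antisymm (card_perm_map_eq X W X hW) (card_perm_map_eq X X W hW.symm)
  have key : ∀ Z : Finset (Fin m),
      (Finset.univ.filter fun π : Equiv.Perm (Fin m) => X.map π.toEmbedding ⊆ Z).card =
        Z.card.choose X.card * c := by
    intro Z
    rw [Finset.card_eq_sum_card_fiberwise (f := fun π : Equiv.Perm (Fin m) => X.map π.toEmbedding)
      (t := Z.powersetCard X.card)]
    · rw [Finset.sum_congr rfl (g := fun _ => c), Finset.sum_const, Finset.card_powersetCard,
        smul_eq_mul]
      intro W hW
      rw [Finset.mem_powersetCard] at hW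
      rw [← hfib W hW.2, Finset.filter_filter]
      congr 1
      ext π
      simp only [Finset.mem_filter, Finset.mem_univ, true_and, and_iff_right_iff_imp]
      rintro rfl
      exact hW.1
    · intro π hπ
      simp only [Finset.coe_filter, Finset.mem_univ, true_and, Set.mem_ofPred_eq] at hπ
      simpa [Finset.mem_powersetCard] using hπ
  -- Taking `Z` to be everything determines the common fibre size `c`.
  have htot : m.factorial = m.choose X.card * c := by
    have := key Finset.univ
    simpa [Fintype.card_perm] using this
  rw [key, htot]
  ring

/-- Factor by factor, `(z - i) / (m - i) ≤ z / m`. With `z = t` it also gives the lower bound `(m /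
t) ^ t` for `m.choose t`. -/
theorem choose_mul_pow_le {z : ℕ} (hz : z ≤ m) (t : ℕ) :
    z.choose t * m ^ t ≤ m.choose t * z ^ t := by
  have key : ∀ t, z.descFactorial t * m ^ t ≤ m.descFactorial t * z ^ t := by
    intro t
    induction t with
    | zero => simp
    | succ t ih =>
      rw [Nat.descFactorial_succ, Nat.descFactorial_succ, pow_succ, pow_succ]
      have h1 : (z - t) * m ≤ (m - t) * z := by
        rw [Nat.sub_mul, Nat.sub_mul, mul_comm m z]
        exact Nat.sub_le_sub_left (Nat.mul_le_mul_left t hz) _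
      calc _ = ((z - t) * m) * (z.descFactorial t * m ^ t) := by ring
        _ ≤ ((m - t) * z) * (m.descFactorial t * z ^ t) := Nat.mul_le_mul h1 ih
        _ = _ := by ring
  have := key t
  rw [Nat.descFactorial_eq_factorial_mul_choose, Nat.descFactorial_eq_factorial_mul_choose,
    mul_assoc, mul_assoc] at this
  exact Nat.le_of_mul_le_mul_left this t.factorial_pos

theorem card_perm_map_subset_le (hm : 0 < m) (X Z : Finset (Fin m)) :
    ((Finset.univ.filter fun π : Equiv.Perm (Fin m) => X.map π.toEmbedding ⊆ Z).card : ℝ) ≤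
      m.factorial * ((Z.card : ℝ) / m) ^ X.card := by
  have h1 := card_perm_map_subset X Z
  have hX : X.card ≤ m := by simpa using X.card_le_univ
  have hZ : Z.card ≤ m := by simpa using Z.card_le_univ
  have h2 := choose_mul_pow_le hZ X.card
  have hc : (0 : ℝ) < m.choose X.card := by exact_mod_cast Nat.choose_pos hX
  have hmr : (0 : ℝ) < (m : ℝ) ^ X.card := by positivity
  rw [div_pow, ← mul_div_assoc, le_div_iff₀ hmr]
  refine le_of_mul_le_mul_right ?_ hc
  have h1' : ((Finset.univ.filter fun π : Equiv.Perm (Fin m) => X.map π.toEmbedding ⊆ Z).card : ℝ)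
      * m.choose X.card = m.factorial * Z.card.choose X.card := by exact_mod_cast h1
  have h2' : (Z.card.choose X.card : ℝ) * m ^ X.card ≤ m.choose X.card * Z.card ^ X.card := by
    exact_mod_cast h2
  rw [mul_right_comm, h1']
  calc _ = (m.factorial : ℝ) * (Z.card.choose X.card * m ^ X.card) := by ring
    _ ≤ m.factorial * (m.choose X.card * Z.card ^ X.card) := by gcongr
    _ = _ := by ring

theorem choose_mul_div_pow_le (hm : 0 < m) (j : ℕ) :
    (m.choose j : ℝ) * ((j : ℝ) / m) ^ j ≤ 3 ^ j := by
  have h1 : (m.choose j : ℝ) ≤ (m : ℝ) ^ j / j.factorial := Nat.choose_le_pow_div j m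
  have h2 : (j : ℝ) ^ j / j.factorial ≤ 3 ^ j := by
    calc (j : ℝ) ^ j / j.factorial ≤ Real.exp j := Real.pow_div_factorial_le_exp _ (by positivity) _
      _ = Real.exp 1 ^ j := by rw [← Real.exp_nat_mul, mul_one]
      _ ≤ 3 ^ j := by gcongr; exact Real.exp_one_lt_three.le
  calc _ ≤ (m : ℝ) ^ j / j.factorial * ((j : ℝ) / m) ^ j := by gcongr
    _ = (j : ℝ) ^ j / j.factorial := by rw [div_pow]; field_simp
    _ ≤ _ := h2

/-- Of the `D + A + 1` factors `ρ ^ t`, one absorbs `m.choose t`, `A` of them absorb `m.choose (A *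
t)`, and the remaining `D` supply the decay, because `ρ ≤ 3 / 4`. -/
theorem union_bound_term {A D t : ℕ} (hm : 0 < m) (hAt : 4 * (A * t) ≤ 3 * m)
    (hD : (3 * A : ℝ) * 3 ^ A * (3 / 4) ^ D ≤ 1 / 4) :
    (m.choose t : ℝ) * m.choose (A * t) * ((((A * t : ℕ) : ℝ) / m) ^ t) ^ (D + A + 1) ≤
      (1 / 4) ^ t := by
  set ρ : ℝ := ((A * t : ℕ) : ℝ) / m with hρ
  have hm' : (0 : ℝ) < m := by exact_mod_cast hm
  have hρ0 : 0 ≤ ρ := by positivity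
  have hρ1 : ρ ≤ 3 / 4 := by
    rw [hρ, div_le_iff₀ hm']
    have : (4 : ℝ) * ((A * t : ℕ) : ℝ) ≤ 3 * m := by exact_mod_cast hAt
    linarith
  have e1 : (m.choose t : ℝ) * ρ ^ t ≤ (3 * A) ^ t := by
    have : ρ = A * ((t : ℝ) / m) := by rw [hρ]; push_cast; ring
    calc (m.choose t : ℝ) * ρ ^ t = A ^ t * (m.choose t * ((t : ℝ) / m) ^ t) := by
          rw [this, mul_pow]; ring
      _ ≤ A ^ t * 3 ^ t := by gcongr; exact choose_mul_div_pow_le hm t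
      _ = _ := by rw [← mul_pow, mul_comm]
  have e2 : (m.choose (A * t) : ℝ) * ρ ^ (A * t) ≤ (3 ^ A) ^ t := by
    rw [← pow_mul]
    exact choose_mul_div_pow_le hm (A * t)
  calc _ = ((m.choose t : ℝ) * ρ ^ t) * (m.choose (A * t) * ρ ^ (A * t)) * (ρ ^ D) ^ t := by
        ring
    _ ≤ (3 * A) ^ t * (3 ^ A) ^ t * ((3 / 4) ^ D) ^ t := by gcongr
    _ = ((3 * A : ℝ) * 3 ^ A * (3 / 4) ^ D) ^ t := by simp only [mul_pow]
    _ ≤ _ := by gcongr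

/-- There are boundedly many permutations whose union expands all small sets by a factor `A`. -/
theorem exists_perm_expander (A : ℕ) (hA : 0 < A) : ∃ D : ℕ, ∀ m : ℕ,
    ∃ π : Fin D → Equiv.Perm (Fin m), ∀ X : Finset (Fin m), 4 * (A * X.card) ≤ 3 * m →
      A * X.card ≤ (Finset.univ.biUnion fun i => X.map (π i).toEmbedding).card := by
  classical
  obtain ⟨D₀, hD₀⟩ : ∃ D : ℕ, (3 / 4 : ℝ) ^ D < 1 / 4 / (3 * A * 3 ^ A) :=
    exists_pow_lt_of_lt_one (by positivity) (by norm_num)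
  have hD : (3 * A : ℝ) * 3 ^ A * (3 / 4) ^ D₀ ≤ 1 / 4 := by
    rw [lt_div_iff₀ (by positivity)] at hD₀
    linarith
  refine ⟨D₀ + A + 1, fun m => ?_⟩
  rcases Nat.eq_zero_or_pos m with rfl | hm
  · refine ⟨fun _ => 1, fun X _ => ?_⟩
    simp [Finset.eq_empty_of_isEmpty X]
  set D := D₀ + A + 1 with hDdef
  by_contra hcon
  push Not at hcon
  -- A tuple that fails to expand some `X` sends it into a set `Z` of exactly `A * X.card` points;
  -- the union bound runs over the pairs `(X, Z)`.
  have hcover : (Finset.univ : Finset (Fin D → Equiv.Perm (Fin m))) ⊆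
      ((Finset.Icc 1 m).filter fun t => 4 * (A * t) ≤ 3 * m).biUnion fun t =>
        ((Finset.univ.powersetCard t : Finset (Finset (Fin m))) ×ˢ
          (Finset.univ.powersetCard (A * t) : Finset (Finset (Fin m)))).biUnion fun XZ =>
            Fintype.piFinset fun _ : Fin D =>
              Finset.univ.filter fun π : Equiv.Perm (Fin m) => XZ.1.map π.toEmbedding ⊆ XZ.2 := by
    intro π _
    obtain ⟨X, hX, hlt⟩ := hcon π
    obtain ⟨Z, hZ, hZc⟩ := Finset.exists_superset_card_eq hlt.le
      (by rw [Fintype.card_fin]; omega : A * X.card ≤ Fintype.card (Fin m))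
    simp only [Finset.mem_biUnion, Finset.mem_filter, Finset.mem_Icc, Finset.mem_product,
      Finset.mem_powersetCard, Finset.subset_univ, true_and, Fintype.mem_piFinset,
      Finset.mem_univ, Prod.exists]
    refine ⟨X.card, ⟨⟨?_, by simpa using X.card_le_univ⟩, hX⟩, X, Z, ⟨rfl, hZc⟩, fun i => ?_⟩
    · rcases Nat.eq_zero_or_pos X.card with h0 | h0
      · rw [h0] at hlt; simp at hlt
      · exact h0
    · exact (Finset.subset_biUnion_of_mem (fun i => X.map (π i).toEmbedding)
        (Finset.mem_univ i)).trans hZ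
  have hfac : (0 : ℝ) < (m.factorial : ℝ) ^ D := by positivity
  have hcount : ((m.factorial : ℝ)) ^ D ≤ ∑ t ∈ (Finset.Icc 1 m).filter (fun t => 4 * (A * t) ≤ 3 * m),
      (m.factorial : ℝ) ^ D * (1 / 4) ^ t := by
    calc ((m.factorial : ℝ)) ^ D
        = ((Finset.univ : Finset (Fin D → Equiv.Perm (Fin m))).card : ℝ) := by
          simp [Fintype.card_perm]
      _ ≤ _ := Nat.cast_le.2 ((Finset.card_le_card hcover).trans Finset.card_biUnion_le)
      _ = _ := Nat.cast_sum _ _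
      _ ≤ _ := by
        refine Finset.sum_le_sum fun t ht => ?_
        rw [Finset.mem_filter] at ht
        have hterm := union_bound_term (D := D₀) hm ht.2 hD
        calc _ ≤ ∑ XZ ∈ ((Finset.univ.powersetCard t : Finset (Finset (Fin m))) ×ˢ
              (Finset.univ.powersetCard (A * t) : Finset (Finset (Fin m)))),
              ((Fintype.piFinset fun _ : Fin D => Finset.univ.filter
                fun π : Equiv.Perm (Fin m) => XZ.1.map π.toEmbedding ⊆ XZ.2).card : ℝ) := by
              exact_mod_cast Finset.card_biUnion_le
          _ ≤ ∑ XZ ∈ ((Finset.univ.powersetCard t : Finset (Finset (Fin m))) ×ˢ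
              (Finset.univ.powersetCard (A * t) : Finset (Finset (Fin m)))),
              ((m.factorial : ℝ) * (((A * t : ℕ) : ℝ) / m) ^ t) ^ D := by
              refine Finset.sum_le_sum fun XZ hXZ => ?_
              simp only [Finset.mem_product, Finset.mem_powersetCard_univ] at hXZ
              rw [Fintype.card_piFinset]
              push_cast
              rw [Finset.prod_const, Finset.card_univ, Fintype.card_fin]
              have := card_perm_map_subset_le hm XZ.1 XZ.2
              rw [hXZ.1, hXZ.2] at this
              push_cast at this
              gcongr
          _ = (m.factorial : ℝ) ^ D * ((m.choose t : ℝ) * m.choose (A * t) *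
                ((((A * t : ℕ) : ℝ) / m) ^ t) ^ D) := by
              rw [Finset.sum_const, Finset.card_product, Finset.card_powersetCard,
                Finset.card_powersetCard, Finset.card_univ, Fintype.card_fin, nsmul_eq_mul,
                mul_pow]
              push_cast
              ring
          _ ≤ _ := by gcongr
  rw [← Finset.mul_sum] at hcount
  have hgeom : ∑ t ∈ (Finset.Icc 1 m).filter (fun t => 4 * (A * t) ≤ 3 * m), (1 / 4 : ℝ) ^ t < 1 := by
    have h1 : ∀ m : ℕ, ∑ t ∈ Finset.Icc 1 m, (1 / 4 : ℝ) ^ t ≤ (1 - (1 / 4) ^ m) / 3 := by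
      intro m
      induction m with
      | zero => simp
      | succ k ih =>
        rw [Finset.sum_Icc_succ_top (by omega), pow_succ]
        linarith
    calc _ ≤ ∑ t ∈ Finset.Icc 1 m, (1 / 4 : ℝ) ^ t :=
          Finset.sum_le_sum_of_subset_of_nonneg (Finset.filter_subset _ _) (by intros; positivity)
      _ ≤ _ := h1 m
      _ < 1 := by
        have : (0 : ℝ) < (1 / 4) ^ m := by positivity
        linarith
  nlinarith

end Permutations

/-! ### Relations with few predecessors, and expanders as relations. -/

/-- Every element has at most `δ` predecessors under `r`. -/
def PredLE {α β : Type*} (r : α → β → Prop) (δ : ℕ) : Prop :=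
  ∀ b, ∃ F : Finset α, F.card ≤ δ ∧ ∀ a, r a b → a ∈ F

theorem PredLE.comp {α β γ : Type*} {r : α → β → Prop} {s : β → γ → Prop} {δ ε : ℕ}
    (hr : PredLE r δ) (hs : PredLE s ε) : PredLE (fun a c => ∃ b, r a b ∧ s b c) (ε * δ) := by
  classical
  intro c
  obtain ⟨F, hF, hF'⟩ := hs c
  choose R hR hR' using hr
  refine ⟨F.biUnion R, (Finset.card_biUnion_le_card_mul _ _ _ fun b _ => hR b).trans
    (Nat.mul_le_mul_right _ hF), ?_⟩
  rintro a ⟨b, hab, hbc⟩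
  exact Finset.mem_biUnion.2 ⟨b, hF' b hbc, hR' b a hab⟩

theorem PredLE.indegreeLE {V : Type*} {G : Digraph V} {δ : ℕ} (h : PredLE G.Adj δ) :
    IndegreeLE G δ := by
  intro v
  obtain ⟨F, hF, hF'⟩ := h v
  calc _ ≤ (F : Set V).encard := Set.encard_le_encard fun u hu => hF' u hu
    _ = F.card := Set.encard_coe_eq_coe_finsetCard F
    _ ≤ δ := by exact_mod_cast hF

theorem exists_expander (A : ℕ) (hA : 0 < A) : ∃ D : ℕ, ∀ m : ℕ,
    ∃ E : Fin m → Fin m → Prop, (∀ x y, E x y → E y x) ∧ PredLE E D ∧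
      ∀ X : Finset (Fin m), 4 * (A * X.card) ≤ 3 * m →
        ∃ Z : Finset (Fin m), A * X.card ≤ Z.card ∧ ∀ z ∈ Z, ∃ x ∈ X, E x z := by
  classical
  obtain ⟨D, hD⟩ := exists_perm_expander A hA
  refine ⟨D + D, fun m => ?_⟩
  obtain ⟨π, hπ⟩ := hD m
  -- The relation is symmetrized so that a common neighbour links two ports in either direction and
  -- successors are bounded as well.
  refine ⟨fun x y => ∃ i, π i x = y ∨ π i y = x, ?_, ?_, fun X hX => ⟨_, hπ X hX, ?_⟩⟩
  · rintro x y ⟨i, h⟩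
    exact ⟨i, h.symm⟩
  · intro y
    refine ⟨(Finset.univ.image fun i => (π i).symm y) ∪ Finset.univ.image fun i => π i y, ?_, ?_⟩
    · refine (Finset.card_union_le _ _).trans (add_le_add ?_ ?_) <;>
        exact Finset.card_image_le.trans (by simp)
    · rintro x ⟨i, rfl | rfl⟩
      · exact Finset.mem_union_left _ (Finset.mem_image.2 ⟨i, by simp⟩)
      · exact Finset.mem_union_right _ (Finset.mem_image.2 ⟨i, by simp⟩)
  · intro z hz
    simp only [Finset.mem_biUnion, Finset.mem_univ, true_and, Finset.mem_map] at hz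
    obtain ⟨i, x, hx, rfl⟩ := hz
    exact ⟨x, hx, i, Or.inl rfl⟩

/-! ### Connectors. -/

/-- One half of a linear-size connector with `m` ports.  Two copies of it, the second one
reversed, linked by the edges `direct`, connect all but few ports after the deletion of few
vertices; this is expressed through labels that increase along edges. -/
structure Connector (δ κ m : ℕ) where
  carrier : Type
  fintype : Fintype carrier
  decEq : DecidableEq carrier
  port : Fin m → carrier
  port_injective : Function.Injective port
  up : carrier → carrier → Prop
  direct : carrier → carrier → Prop
  rank : carrier → ℕ
  rank_lt : ∀ a b, up a b → rank a < rank b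
  -- Ports are sources, so a new layer can feed into them without adding to existing indegrees.
  not_up_port : ∀ a x, ¬ up a (port x)
  card_le : Fintype.card carrier ≤ 2 * m
  up_pred : PredLE up δ
  -- In the reversed copy successors become predecessors.
  up_succ : PredLE (fun a b => up b a) δ
  direct_pred : PredLE direct δ
  -- `f` labels the copy with deletions `S`, `g` the reversed copy with deletions `T`. Separating
  -- `X` from `Y` costs at least `κ` deletions per port of the smaller set.
  connect : ∀ (S T : Finset carrier) (f g : carrier → ℕ) (X Y : Finset (Fin m)),
    (∀ a b, a ∉ S → b ∉ S → up a b → f a < f b) →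
    (∀ a b, a ∉ T → b ∉ T → up a b → g b < g a) →
    (∀ a b, a ∉ S → b ∉ T → direct a b → f a < g b) →
    (∀ x ∈ X, port x ∉ S) → (∀ y ∈ Y, port y ∉ T) →
    S.card + T.card < κ * X.card → S.card + T.card < κ * Y.card →
    ∃ x ∈ X, ∃ y ∈ Y, f (port x) < g (port y)

attribute [instance] Connector.fintype Connector.decEq

/-- The connector in which all ports are directly linked. -/
def Connector.complete (δ κ m : ℕ) (h : m ≤ δ) : Connector δ κ m where
  carrier := Fin m
  fintype := inferInstance
  decEq := inferInstance
  port := id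
  port_injective := Function.injective_id
  up _ _ := False
  direct _ _ := True
  rank _ := 0
  rank_lt _ _ h := h.elim
  not_up_port _ _ h := h
  card_le := by simp; omega
  up_pred _ := ⟨∅, by simp, fun _ h => h.elim⟩
  up_succ _ := ⟨∅, by simp, fun _ h => h.elim⟩
  direct_pred _ := ⟨Finset.univ, by simpa using h, fun _ _ => Finset.mem_univ _⟩
  connect S T f g X Y _ _ hfg hX hY hXc hYc := by
    obtain ⟨x, hx⟩ : X.Nonempty := Finset.card_pos.1 (Nat.pos_of_ne_zero (by rintro h; simp [h] at hXc))
    obtain ⟨y, hy⟩ : Y.Nonempty := Finset.card_pos.1 (Nat.pos_of_ne_zero (by rintro h; simp [h] at hYc))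
    exact ⟨x, hx, y, hy, hfg _ _ (hX x hx) (hY y hy) trivial⟩

/-- The up-edges of a connector extended by a new layer of ports. -/
inductive ExtendUp {m m' : ℕ} {H : Type} (E : Fin m → Fin m → Prop) (q : Fin m → Fin m')
    (port : Fin m' → H) (up : H → H → Prop) : Fin m ⊕ H → Fin m ⊕ H → Prop
  | enter (u y : Fin m) : E u y → ExtendUp E q port up (.inl u) (.inr (port (q y)))
  | lift (a b : H) : up a b → ExtendUp E q port up (.inr a) (.inr b)

/-- The direct edges of a connector extended by a new layer of ports. -/
inductive ExtendDirect {m : ℕ} {H : Type} (E : Fin m → Fin m → Prop) (direct : H → H → Prop) :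
    Fin m ⊕ H → Fin m ⊕ H → Prop
  | ports (u v : Fin m) : (∃ z, E u z ∧ E z v) → ExtendDirect E direct (.inl u) (.inl v)
  | lift (a b : H) : direct a b → ExtendDirect E direct (.inr a) (.inr b)

theorem card_fiber_le {m m' b : ℕ} (hb : 0 < b) (q : Fin m → Fin m')
    (hq : ∀ y, (q y : ℕ) = y / b) (w : Fin m') :
    (Finset.univ.filter fun y => q y = w).card ≤ b := by
  calc _ ≤ (Finset.range b).card := by
        refine Finset.card_le_card_of_injOn (fun y : Fin m => (y : ℕ) % b) ?_ ?_
        · intro y _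
          simpa using Nat.mod_lt _ hb
        · intro y hy y' hy' hyy
          simp only [Finset.coe_filter, Finset.mem_univ, true_and, Set.mem_ofPred_eq] at hy hy'
          have h2 := hq y
          have h3 := hq y'
          rw [hy] at h2
          rw [hy'] at h3
          refine Fin.ext ?_
          rw [← Nat.div_add_mod (y : ℕ) b, ← Nat.div_add_mod (y' : ℕ) b, ← h2, ← h3]
          simp only at hyy
          rw [hyy]
    _ = b := Finset.card_range b

/-- Merging `b` points into one port costs a factor `b`, which `A = 2 * κ * b` allows for; each
deletion then kills at most one port. -/
theorem exists_expanded_ports {m m' b κ A t : ℕ} (hb : 0 < b) (hA : A = 2 * κ * b)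
    {E : Fin m → Fin m → Prop}
    (hE : ∀ X : Finset (Fin m), 4 * (A * X.card) ≤ 3 * m →
        ∃ Z : Finset (Fin m), A * X.card ≤ Z.card ∧ ∀ z ∈ Z, ∃ x ∈ X, E x z)
    (q : Fin m → Fin m') (hq : ∀ y, (q y : ℕ) = y / b)
    {H : Type} [DecidableEq H] (port : Fin m' → H) (hport : Function.Injective port)
    (S : Finset H) (X : Finset (Fin m)) (htX : t ≤ X.card) (htm : 2 * (A * t) ≤ m) :
    ∃ W : Finset (Fin m'), 2 * κ * t ≤ W.card + S.card ∧
      ∀ w ∈ W, port w ∉ S ∧ ∃ x ∈ X, ∃ y, E x y ∧ q y = w := by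
  classical
  obtain ⟨X', hX', rfl⟩ := Finset.exists_subset_card_eq htX
  obtain ⟨Z, hZ, hZE⟩ := hE X' (by omega)
  refine ⟨(Z.image q).filter fun w => port w ∉ S, ?_, ?_⟩
  · have h1 : Z.card ≤ b * (Z.image q).card := by
      refine Finset.card_le_mul_card_image Z b fun w _ => ?_
      exact (Finset.card_le_card (Finset.filter_subset_filter _ (Finset.subset_univ Z))).trans
        (card_fiber_le hb q hq w)
    have h2 : ((Z.image q).filter fun w => ¬ port w ∉ S).card ≤ S.card := by
      refine Finset.card_le_card_of_injOn port ?_ hport.injOn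
      intro w hw
      simp only [Finset.coe_filter, Set.mem_ofPred_eq, not_not] at hw
      exact hw.2
    have h3 := Finset.card_filter_add_card_filter_not (s := Z.image q) (fun w => port w ∉ S)
    have h4 : 2 * κ * X'.card ≤ (Z.image q).card := by
      refine Nat.le_of_mul_le_mul_left ?_ hb
      calc _ = A * X'.card := by rw [hA]; ring
        _ ≤ _ := hZ.trans h1
    omega
  · intro w hw
    obtain ⟨hw, hwS⟩ := Finset.mem_filter.1 hw
    obtain ⟨y, hy, rfl⟩ := Finset.mem_image.1 hw
    obtain ⟨x, hx, hxy⟩ := hZE y hy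
    exact ⟨hwS, x, hX' hx, y, hxy, rfl⟩

theorem card_filter_inr_le {α β : Type*} [Fintype β] [DecidableEq α] [DecidableEq β]
    (S : Finset (α ⊕ β)) : (Finset.univ.filter fun a : β => Sum.inr a ∈ S).card ≤ S.card := by
  refine Finset.card_le_card_of_injOn Sum.inr ?_ Sum.inr_injective.injOn
  intro a ha
  simpa using ha

/-- Adding a layer of ports to a connector by means of an expander. -/
def Connector.extend {δ κ m m' b A D : ℕ} (C : Connector δ κ m') (hκ : 0 < κ) (hb : 0 < b)
    (hA : A = 2 * κ * b) (hm : 4 * A ≤ m) (hm' : 2 * m' ≤ m)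
    (E : Fin m → Fin m → Prop) (hsymm : ∀ x y, E x y → E y x) (hdeg : PredLE E D)
    (hE : ∀ X : Finset (Fin m), 4 * (A * X.card) ≤ 3 * m →
        ∃ Z : Finset (Fin m), A * X.card ≤ Z.card ∧ ∀ z ∈ Z, ∃ x ∈ X, E x z)
    (q : Fin m → Fin m') (hq : ∀ y, (q y : ℕ) = y / b)
    (hδ : b * D + D * D ≤ δ) : Connector δ κ m where
  carrier := Fin m ⊕ C.carrier
  fintype := inferInstance
  decEq := inferInstance
  port := Sum.inl
  port_injective := Sum.inl_injective
  up := ExtendUp E q C.port C.up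
  direct := ExtendDirect E C.direct
  rank := Sum.elim (fun _ => 0) (fun a => C.rank a + 1)
  rank_lt := by
    rintro _ _ (⟨u, y, -⟩ | ⟨a, b, h⟩)
    · simp
    · simpa using C.rank_lt _ _ h
  not_up_port := by
    rintro a x ⟨⟩
  card_le := by
    have := C.card_le
    rw [Fintype.card_sum, Fintype.card_fin]
    omega
  up_pred := by
    classical
    rintro (u | a)
    · exact ⟨∅, by simp, by rintro _ ⟨⟩⟩
    by_cases ha : ∃ w, C.port w = a
    · obtain ⟨w, rfl⟩ := ha
      have hfib : PredLE (fun y w => q y = w) b := by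
        intro w
        exact ⟨Finset.univ.filter fun y => q y = w, card_fiber_le hb q hq w, by simp⟩
      obtain ⟨F, hF, hF'⟩ := hdeg.comp hfib w
      refine ⟨F.image Sum.inl, Finset.card_image_le.trans (hF.trans (by omega)), ?_⟩
      intro c hc
      generalize hz : (Sum.inr (C.port w) : Fin m ⊕ C.carrier) = z at hc
      cases hc with
      | enter u y huy =>
        exact Finset.mem_image_of_mem _ (hF' u ⟨y, huy, (C.port_injective (Sum.inr_injective hz)).symm⟩)
      | lift a b h =>
        cases Sum.inr_injective hz
        exact (C.not_up_port _ _ h).elim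
    · obtain ⟨F, hF, hF'⟩ := C.up_pred a
      refine ⟨F.image Sum.inr, Finset.card_image_le.trans hF, ?_⟩
      intro c hc
      generalize hz : (Sum.inr a : Fin m ⊕ C.carrier) = z at hc
      cases hc with
      | enter u y huy => exact (ha ⟨_, (Sum.inr_injective hz).symm⟩).elim
      | lift a b h =>
        cases Sum.inr_injective hz
        exact Finset.mem_image_of_mem _ (hF' _ h)
  up_succ := by
    classical
    rintro (u | a)
    · obtain ⟨F, hF, hF'⟩ := hdeg u
      refine ⟨F.image fun y => Sum.inr (C.port (q y)), Finset.card_image_le.trans (hF.trans ?_), ?_⟩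
      · nlinarith
      · rintro _ ⟨_, y, h⟩
        exact Finset.mem_image.2 ⟨y, hF' y (hsymm _ _ h), rfl⟩
    · obtain ⟨F, hF, hF'⟩ := C.up_succ a
      refine ⟨F.image Sum.inr, Finset.card_image_le.trans hF, ?_⟩
      rintro _ (_ | ⟨_, c, h⟩)
      exact Finset.mem_image_of_mem _ (hF' _ h)
  direct_pred := by
    classical
    rintro (u | a)
    · obtain ⟨F, hF, hF'⟩ := hdeg.comp hdeg u
      refine ⟨F.image Sum.inl, Finset.card_image_le.trans (hF.trans (by omega)), ?_⟩
      rintro _ (⟨v, _, h⟩ | _)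
      exact Finset.mem_image_of_mem _ (hF' _ h)
    · obtain ⟨F, hF, hF'⟩ := C.direct_pred a
      refine ⟨F.image Sum.inr, Finset.card_image_le.trans hF, ?_⟩
      rintro _ (_ | ⟨c, _, h⟩)
      exact Finset.mem_image_of_mem _ (hF' _ h)
  connect := by
    classical
    intro S T f g X Y hf hg hfg hX hY hXc hYc
    obtain ⟨t, htX, htY, ht⟩ : ∃ t, t ≤ X.card ∧ t ≤ Y.card ∧ S.card + T.card < κ * t := by
      rcases le_total X.card Y.card with h | h
      · exact ⟨_, le_rfl, h, hXc⟩
      · exact ⟨_, h, le_rfl, hYc⟩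
    have hApos : 0 < A := by rw [hA]; positivity
    -- If `t` is large, shrink it to `t'` with `m / 2 < A * t' ≤ 3 * m / 4`. Both neighbourhoods
    -- then exceed half of the points and meet, which gives a direct edge.
    by_cases hbig : m < 2 * (A * t)
    · set t' := m / (2 * A) + 1 with ht'
      have hd1 := Nat.div_add_mod m (2 * A)
      have hd2 := Nat.mod_lt m (show 0 < 2 * A by omega)
      have hAt' : A * t' = A * (m / (2 * A)) + A := by rw [ht']; ring
      have hd3 : 2 * A * (m / (2 * A)) = 2 * (A * (m / (2 * A))) := by ring
      have ht't : t' ≤ t := by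
        rw [ht']
        refine Nat.succ_le_of_lt ((Nat.div_lt_iff_lt_mul (by omega)).2 ?_)
        linarith
      obtain ⟨X', hX', hX'c⟩ := Finset.exists_subset_card_eq (ht't.trans htX)
      obtain ⟨Y', hY', hY'c⟩ := Finset.exists_subset_card_eq (ht't.trans htY)
      obtain ⟨Z, hZ, hZE⟩ := hE X' (by rw [hX'c]; omega)
      obtain ⟨Z', hZ', hZE'⟩ := hE Y' (by rw [hY'c]; omega)
      rw [hX'c] at hZ
      rw [hY'c] at hZ'
      obtain ⟨z, hz⟩ : (Z ∩ Z').Nonempty := by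
        have h1 := Finset.card_union_add_card_inter Z Z'
        have h2 : (Z ∪ Z').card ≤ m := by simpa using (Z ∪ Z').card_le_univ
        exact Finset.card_pos.1 (by omega)
      rw [Finset.mem_inter] at hz
      obtain ⟨x, hx, hxz⟩ := hZE z hz.1
      obtain ⟨y, hy, hyz⟩ := hZE' z hz.2
      exact ⟨x, hX' hx, y, hY' hy, hfg _ _ (hX x (hX' hx)) (hY y (hY' hy))
        (.ports x y ⟨z, hxz, hsymm _ _ hyz⟩)⟩
    -- If `t` is small, each side reaches at least `2 * κ * t` inner ports, fewer than `κ * t` of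
    -- them dead. More than `κ * t` live ones remain, enough for the inner connector.
    · rw [not_lt] at hbig
      have hS := card_filter_inr_le S
      have hT := card_filter_inr_le T
      obtain ⟨W, hW, hWE⟩ := exists_expanded_ports hb hA hE q hq C.port C.port_injective
        (Finset.univ.filter fun a => Sum.inr a ∈ S) X htX hbig
      obtain ⟨W', hW', hWE'⟩ := exists_expanded_ports hb hA hE q hq C.port C.port_injective
        (Finset.univ.filter fun a => Sum.inr a ∈ T) Y htY hbig
      have h2 : 2 * κ * t = κ * t + κ * t := by ring
      have h3 : W.card ≤ κ * W.card := Nat.le_mul_of_pos_left _ hκ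
      have h4 : W'.card ≤ κ * W'.card := Nat.le_mul_of_pos_left _ hκ
      obtain ⟨w, hw, w', hw', hlt⟩ := C.connect
        (Finset.univ.filter fun a => Sum.inr a ∈ S) (Finset.univ.filter fun a => Sum.inr a ∈ T)
        (fun a => f (.inr a)) (fun a => g (.inr a)) W W'
        (fun a b ha hb h => hf _ _ (by simpa using ha) (by simpa using hb) (.lift a b h))
        (fun a b ha hb h => hg _ _ (by simpa using ha) (by simpa using hb) (.lift a b h))
        (fun a b ha hb h => hfg _ _ (by simpa using ha) (by simpa using hb) (.lift a b h))
        (fun w hw => (hWE w hw).1) (fun w hw => (hWE' w hw).1) (by omega) (by omega)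
      obtain ⟨hwS, x, hx, u, hxu, rfl⟩ := hWE w hw
      obtain ⟨hwT, y, hy, v, hyv, rfl⟩ := hWE' w' hw'
      refine ⟨x, hx, y, hy, ?_⟩
      have e1 := hf _ _ (hX x hx) (by simpa using hwS) (.enter x u hxu)
      have e2 := hg _ _ (hY y hy) (by simpa using hwT) (.enter y v hyv)
      omega

/-- Linear-size connectors of bounded degree exist for any number of ports. -/
theorem exists_connector (κ : ℕ) (hκ : 0 < κ) : ∃ δ : ℕ, ∀ m, Nonempty (Connector δ κ m) := by
  set A := 2 * κ * 4 with hA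
  have hApos : 0 < A := by positivity
  obtain ⟨D, hD⟩ := exists_expander A hApos
  refine ⟨4 * A + 4 * D + D * D, fun m => ?_⟩
  induction m using Nat.strong_induction_on with
  | _ m ih =>
    by_cases hm : m < 4 * A
    · exact ⟨.complete _ _ _ (by omega)⟩
    · rw [not_lt] at hm
      -- Ports are merged four at a time; as `m` is large, `2 * (m / 4 + 1) ≤ m`, so the size bound
      -- `2 * m` reproduces itself.
      obtain ⟨C⟩ := ih (m / 4 + 1) (by omega)
      obtain ⟨E, hsymm, hdeg, hE⟩ := hD m
      exact ⟨C.extend hκ (by omega) hA hm (by omega) E hsymm hdeg hE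
        (fun y => ⟨y / 4, by have := y.2; omega⟩) (fun y => rfl) (by omega)⟩

namespace Connector

variable {δ κ m : ℕ} (C : Connector δ κ m)

theorem card_ge : m ≤ Fintype.card C.carrier := by
  simpa using Fintype.card_le_of_injective _ C.port_injective

theorem exists_threshold (S T : Finset C.carrier) (f g : C.carrier → ℕ) (d : ℕ)
    (hfd : ∀ a, a ∉ S → f a < d)
    (hf : ∀ a b, a ∉ S → b ∉ S → C.up a b → f a < f b)
    (hg : ∀ a b, a ∉ T → b ∉ T → C.up a b → g b < g a)
    (hfg : ∀ a b, a ∉ S → b ∉ T → C.direct a b → f a < g b) :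
    ∃ t ≤ d, κ * (Finset.univ.filter fun x => C.port x ∉ S ∧ t ≤ f (C.port x)).card ≤
        S.card + T.card ∧
      κ * (Finset.univ.filter fun y => C.port y ∉ T ∧ g (C.port y) < t).card ≤
        S.card + T.card :=
  DepthRobust.exists_threshold κ (S.card + T.card) d _ _ (fun x => f (C.port x))
    (fun y => g (C.port y)) (fun _ hx => hfd _ hx)
    fun X Y hX hY hXc hYc => C.connect S T f g X Y hf hg hfg hX hY hXc hYc

end Connector

/-! ### The tree of connectors: acyclicity, indegree, size. -/

/-- The data of a tree of connectors: the leaves are the numbers below `size`, written in base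
`base` with `height` digits. Every block of `base ^ j` consecutive leaves carries two copies of the
connector `block j`, and every leaf carries two copies of the connector `hub`. -/
structure Layout (δ : ℕ) where
  base : ℕ
  size : ℕ
  height : ℕ
  base_pos : 0 < base
  dvd : ∀ j : Fin height, base ^ (j : ℕ) ∣ size
  size_le : size ≤ base ^ height
  -- The connector constant equals `base`, to offset that a block is paired with up to `base`
  -- siblings.
  block : ∀ j : Fin height, Connector δ base (base ^ (j : ℕ))
  hub : Connector δ base height

namespace Layout

variable {δ : ℕ} (L : Layout δ)

/-- The vertices of the tree of connectors. -/
inductive Vertex : Type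
  | out (j : Fin L.height) (c : Fin (L.size / L.base ^ (j : ℕ))) (a : (L.block j).carrier) : Vertex
  | inn (j : Fin L.height) (c : Fin (L.size / L.base ^ (j : ℕ))) (a : (L.block j).carrier) : Vertex
  | entry (x : Fin L.size) (a : L.hub.carrier) : Vertex
  | exit (x : Fin L.size) (a : L.hub.carrier) : Vertex

/-- The block of level `j` that contains the leaf `x`. -/
def child (x : Fin L.size) (j : Fin L.height) : Fin (L.size / L.base ^ (j : ℕ)) :=
  ⟨x / L.base ^ (j : ℕ), Nat.div_lt_div_of_lt_of_dvd (L.dvd j) x.2⟩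

/-- The position of the leaf `x` in its block of level `j`. -/
def offset (x : Fin L.size) (j : Fin L.height) : Fin (L.base ^ (j : ℕ)) :=
  ⟨x % L.base ^ (j : ℕ), Nat.mod_lt _ (pow_pos L.base_pos _)⟩

/-- The block `c` precedes the block `c'` in the same parent block. -/
def Sib {M : ℕ} (c c' : Fin M) : Prop := c < c' ∧ (c : ℕ) / L.base = (c' : ℕ) / L.base

/-- The edges of the tree of connectors. -/
inductive Edge : L.Vertex → L.Vertex → Prop
  | outUp (j c a a') : (L.block j).up a a' → Edge (.out j c a) (.out j c a')
  | inDown (j c a a') : (L.block j).up a a' → Edge (.inn j c a') (.inn j c a)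
  | cross (j c c' a a') : L.Sib c c' → (L.block j).direct a a' → Edge (.out j c a) (.inn j c' a')
  | entryUp (x a a') : L.hub.up a a' → Edge (.entry x a) (.entry x a')
  | exitDown (x a a') : L.hub.up a a' → Edge (.exit x a') (.exit x a)
  | through (x a a') : L.hub.direct a a' → Edge (.entry x a) (.exit x a')
  | enter (x j) : Edge (.inn j (L.child x j) ((L.block j).port (L.offset x j)))
      (.entry x (L.hub.port j))
  | leave (x j) : Edge (.exit x (L.hub.port j))
      (.out j (L.child x j) ((L.block j).port (L.offset x j)))

/-- The tree of connectors as a digraph. -/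
def graph : Digraph L.Vertex where
  Adj := L.Edge

/-- A topological ranking of the vertices. -/
def potential : L.Vertex → ℕ ×ₗ ℤ
  -- An in-copy sits just after the start of its block, the hubs of a leaf at the leaf, an out-copy
  -- at the end of its block. The offsets 0 to 3 place an out-copy ending where the next block
  -- starts before that block's in-copy. Ranks order the interior of a copy, with a minus sign for
  -- reversed copies.
  | .out j c a => toLex (4 * ((c + 1) * L.base ^ (j : ℕ)), (L.block j).rank a)
  | .inn j c a => toLex (4 * (c * L.base ^ (j : ℕ)) + 1, -(L.block j).rank a)
  | .entry x a => toLex (4 * x + 2, L.hub.rank a)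
  | .exit x a => toLex (4 * x + 3, -L.hub.rank a)

theorem isAcyclic : IsAcyclic L.graph := by
  refine isAcyclic_of_strictMono L.potential ?_
  intro u v h
  rw [Prod.Lex.lt_iff]
  cases h with
  | outUp j c a a' h => exact Or.inr ⟨rfl, by simpa [potential] using (L.block j).rank_lt _ _ h⟩
  | inDown j c a a' h => exact Or.inr ⟨rfl, by simpa [potential] using (L.block j).rank_lt _ _ h⟩
  | cross j c c' a a' h _ =>
    refine Or.inl ?_
    have h1 : (c : ℕ) + 1 ≤ c' := h.1
    have := Nat.mul_le_mul_right (L.base ^ (j : ℕ)) h1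
    simp only [potential, ofLex_toLex]
    omega
  | entryUp x a a' h => exact Or.inr ⟨rfl, by simpa [potential] using L.hub.rank_lt _ _ h⟩
  | exitDown x a a' h => exact Or.inr ⟨rfl, by simpa [potential] using L.hub.rank_lt _ _ h⟩
  | through x a a' h => exact Or.inl (by simp [potential])
  | enter x j =>
    refine Or.inl ?_
    have := Nat.div_mul_le_self (x : ℕ) (L.base ^ (j : ℕ))
    simp only [potential, ofLex_toLex, child]
    omega
  | leave x j =>
    refine Or.inl ?_
    have h1 := Nat.div_add_mod (x : ℕ) (L.base ^ (j : ℕ))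
    have h2 := Nat.mod_lt (x : ℕ) (pow_pos L.base_pos (j : ℕ))
    have h3 : ((x : ℕ) / L.base ^ (j : ℕ) + 1) * L.base ^ (j : ℕ) =
      L.base ^ (j : ℕ) * ((x : ℕ) / L.base ^ (j : ℕ)) + L.base ^ (j : ℕ) := by ring
    simp only [potential, ofLex_toLex, child, h3]
    omega

theorem leaf_ext {x y : Fin L.size} {j : Fin L.height} (hc : L.child x j = L.child y j)
    (ho : L.offset x j = L.offset y j) : x = y := by
  have h1 := congrArg Fin.val hc
  have h2 := congrArg Fin.val ho
  simp only [child, offset] at h1 h2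
  refine Fin.ext ?_
  rw [← Nat.div_add_mod (x : ℕ) (L.base ^ (j : ℕ)), h1, h2, Nat.div_add_mod]

theorem card_same_parent_le {M : ℕ} (c : Fin M) :
    (Finset.univ.filter fun c' : Fin M => (c' : ℕ) / L.base = (c : ℕ) / L.base).card ≤ L.base := by
  have := card_fiber_le L.base_pos
    (fun y : Fin M => (⟨y / L.base, (Nat.div_le_self _ _).trans_lt y.2⟩ : Fin M)) (fun _ => rfl)
    ⟨c / L.base, (Nat.div_le_self _ _).trans_lt c.2⟩
  simpa using this

theorem predLE : PredLE L.graph.Adj (L.base * δ + 2 * δ + 1) := by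
  classical
  rintro (⟨j, c, a⟩ | ⟨j, c, a⟩ | ⟨x, a⟩ | ⟨x, a⟩)
  · obtain ⟨F, hF, hF'⟩ := (L.block j).up_pred a
    refine ⟨F.image (.out j c) ∪ (Finset.univ.filter fun x : Fin L.size => L.child x j = c ∧
      (L.block j).port (L.offset x j) = a).image (fun x => .exit x (L.hub.port j)), ?_, ?_⟩
    · refine (Finset.card_union_le _ _).trans ((add_le_add (Finset.card_image_le.trans hF)
        (Finset.card_image_le.trans (Finset.card_le_one.2 ?_))).trans (by omega : δ + 1 ≤ _))
      intro x hx y hy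
      simp only [Finset.mem_filter, Finset.mem_univ, true_and] at hx hy
      exact L.leaf_ext (hx.1.trans hy.1.symm) ((L.block j).port_injective (hx.2.trans hy.2.symm))
    · intro u hu
      cases hu with
      | outUp _ _ a' _ h => exact Finset.mem_union_left _ (Finset.mem_image_of_mem _ (hF' _ h))
      | leave x _ =>
        exact Finset.mem_union_right _ (Finset.mem_image.2 ⟨x, by simp, rfl⟩)
  · obtain ⟨F, hF, hF'⟩ := (L.block j).up_succ a
    obtain ⟨R, hR, hR'⟩ := (L.block j).direct_pred a
    refine ⟨F.image (.inn j c) ∪ ((Finset.univ.filter fun c' : Fin _ =>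
      (c' : ℕ) / L.base = (c : ℕ) / L.base) ×ˢ R).image (fun p => .out j p.1 p.2), ?_, ?_⟩
    · refine (Finset.card_union_le _ _).trans ((add_le_add (Finset.card_image_le.trans hF)
        (Finset.card_image_le.trans ?_)).trans (by omega : δ + L.base * δ ≤ _))
      rw [Finset.card_product]
      exact Nat.mul_le_mul (L.card_same_parent_le c) hR
    · intro u hu
      cases hu with
      | inDown _ _ _ a' h => exact Finset.mem_union_left _ (Finset.mem_image_of_mem _ (hF' _ h))
      | cross _ c' _ a' _ hs h =>
        refine Finset.mem_union_right _ (Finset.mem_image.2 ⟨(c', a'), ?_, rfl⟩)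
        exact Finset.mem_product.2 ⟨by simpa using hs.2, hR' _ h⟩
  · obtain ⟨F, hF, hF'⟩ := L.hub.up_pred a
    refine ⟨F.image (.entry x) ∪ (Finset.univ.filter fun j => L.hub.port j = a).image
      (fun j => .inn j (L.child x j) ((L.block j).port (L.offset x j))), ?_, ?_⟩
    · refine (Finset.card_union_le _ _).trans ((add_le_add (Finset.card_image_le.trans hF)
        (Finset.card_image_le.trans (Finset.card_le_one.2 ?_))).trans (by omega : δ + 1 ≤ _))
      intro i hi j hj
      simp only [Finset.mem_filter, Finset.mem_univ, true_and] at hi hj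
      exact L.hub.port_injective (hi.trans hj.symm)
    · intro u hu
      cases hu with
      | entryUp _ a' _ h => exact Finset.mem_union_left _ (Finset.mem_image_of_mem _ (hF' _ h))
      | enter _ j =>
        exact Finset.mem_union_right _ (Finset.mem_image.2 ⟨j, by simp, rfl⟩)
  · obtain ⟨F, hF, hF'⟩ := L.hub.up_succ a
    obtain ⟨R, hR, hR'⟩ := L.hub.direct_pred a
    refine ⟨F.image (.exit x) ∪ R.image (.entry x), ?_, ?_⟩
    · exact (Finset.card_union_le _ _).trans ((add_le_add (Finset.card_image_le.trans hF)
        (Finset.card_image_le.trans hR)).trans (by omega))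
    · intro u hu
      cases hu with
      | exitDown _ _ a' h => exact Finset.mem_union_left _ (Finset.mem_image_of_mem _ (hF' _ h))
      | through _ a' _ h => exact Finset.mem_union_right _ (Finset.mem_image_of_mem _ (hR' _ h))

/-- The vertices as a disjoint union. -/
def vertexEquiv : L.Vertex ≃
    ((Σ j : Fin L.height, Fin (L.size / L.base ^ (j : ℕ)) × (L.block j).carrier) ⊕
      (Σ j : Fin L.height, Fin (L.size / L.base ^ (j : ℕ)) × (L.block j).carrier)) ⊕
    ((Fin L.size × L.hub.carrier) ⊕ (Fin L.size × L.hub.carrier)) where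
  toFun
    | .out j c a => .inl (.inl ⟨j, c, a⟩)
    | .inn j c a => .inl (.inr ⟨j, c, a⟩)
    | .entry x a => .inr (.inl (x, a))
    | .exit x a => .inr (.inr (x, a))
  invFun
    | .inl (.inl ⟨j, c, a⟩) => .out j c a
    | .inl (.inr ⟨j, c, a⟩) => .inn j c a
    | .inr (.inl (x, a)) => .entry x a
    | .inr (.inr (x, a)) => .exit x a
  left_inv := by rintro (_ | _ | _ | _) <;> rfl
  right_inv := by rintro ((_ | _) | (_ | _)) <;> rfl

noncomputable instance : Fintype L.Vertex := Fintype.ofEquiv _ L.vertexEquiv.symm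

theorem card_vertex_le : Fintype.card L.Vertex ≤ 8 * (L.size * L.height) := by
  rw [Fintype.card_congr L.vertexEquiv]
  simp only [Fintype.card_sum, Fintype.card_sigma, Fintype.card_prod, Fintype.card_fin]
  have h1 : ∑ j : Fin L.height, L.size / L.base ^ (j : ℕ) * Fintype.card (L.block j).carrier ≤
      L.height * (2 * L.size) := by
    calc _ ≤ ∑ j : Fin L.height, 2 * L.size := by
          refine Finset.sum_le_sum fun j _ => ?_
          calc _ ≤ L.size / L.base ^ (j : ℕ) * (2 * L.base ^ (j : ℕ)) :=
                Nat.mul_le_mul_left _ (L.block j).card_le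
            _ = 2 * (L.size / L.base ^ (j : ℕ) * L.base ^ (j : ℕ)) := by ring
            _ ≤ _ := Nat.mul_le_mul_left _ (Nat.div_mul_le_self _ _)
      _ = _ := by simp
  have h2 := Nat.mul_le_mul_left L.size L.hub.card_le
  nlinarith

theorem le_card_vertex : L.size * L.height ≤ Fintype.card L.Vertex := by
  rw [Fintype.card_congr L.vertexEquiv]
  simp only [Fintype.card_sum, Fintype.card_prod, Fintype.card_fin]
  have := Nat.mul_le_mul_left L.size L.hub.card_ge
  omega

end Layout

/-! ### Counting lemmas. -/

theorem sum_card_filter_mem_le {ι V : Type*} [Fintype ι] {α : ι → Type*} [∀ i, Fintype (α i)]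
    [DecidableEq V] (φ : ∀ i, α i → V)
    (hφ : Function.Injective fun p : Sigma α => φ p.1 p.2) (S : Finset V) :
    ∑ i, (Finset.univ.filter fun a => φ i a ∈ S).card ≤ S.card := by
  rw [← Finset.card_sigma]
  refine Finset.card_le_card_of_injOn (fun p : Sigma α => φ p.1 p.2) ?_ hφ.injOn
  intro p hp
  simpa using hp

/-- A set of at most `s` elements is the set of values of an `s`-tuple whose entries may be blank.
-/
theorem card_filter_card_le (α : Type*) [Fintype α] [DecidableEq α] (s : ℕ) :
    (Finset.univ.filter fun W : Finset α => W.card ≤ s).card ≤ (Fintype.card α + 1) ^ s := by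
  calc _ ≤ (Finset.univ : Finset (Fin s → Option α)).card := by
        refine Finset.card_le_card_of_surjOn
          (fun f => Finset.univ.filter fun a => ∃ i, f i = some a) ?_
        intro W hW
        simp only [Finset.coe_filter, Finset.mem_univ, true_and, Set.mem_ofPred_eq] at hW
        refine ⟨fun i => if hi : (i : ℕ) < W.card then some (W.equivFin.symm ⟨i, hi⟩) else none,
          by simp, ?_⟩
        ext a
        simp only [Finset.mem_filter, Finset.mem_univ, true_and]
        constructor
        · rintro ⟨i, hi⟩
          split_ifs at hi with h
          rw [Option.some.injEq] at hi
          rw [← hi]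
          exact (W.equivFin.symm ⟨i, h⟩).2
        · intro ha
          refine ⟨⟨W.equivFin ⟨a, ha⟩, (W.equivFin ⟨a, ha⟩).2.trans_le hW⟩, ?_⟩
          simp
    _ = _ := by simp

/-- The union bound for bad pairs, multiplied by `b` so that this factor can be cancelled against a
sum over sibling pairs. -/
theorem mul_card_biUnion_le {ι α : Type*} [Fintype ι] [DecidableEq α] {β : ι → Type*}
    [∀ i, Fintype (β i)] (R : ∀ i, β i → β i → Prop) [∀ i c, DecidablePred (R i c)]
    (F : ∀ i, β i → β i → Finset α) (w : ∀ i, β i → β i → ℕ) (b : ℕ)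
    (h : ∀ i c c', R i c c' → b * (F i c c').card ≤ w i c c') :
    b * (Finset.univ.biUnion fun i => Finset.univ.biUnion fun c =>
      (Finset.univ.filter (R i c)).biUnion (F i c)).card ≤
        ∑ i, ∑ c, ∑ c' ∈ Finset.univ.filter (R i c), w i c c' := by
  calc _ ≤ b * ∑ i, ∑ c, ∑ c' ∈ Finset.univ.filter (R i c), (F i c c').card :=
        Nat.mul_le_mul_left _ (Finset.card_biUnion_le.trans (Finset.sum_le_sum fun i _ =>
          Finset.card_biUnion_le.trans (Finset.sum_le_sum fun c _ => Finset.card_biUnion_le)))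
    _ ≤ _ := by
      simp only [Finset.mul_sum]
      exact Finset.sum_le_sum fun i _ => Finset.sum_le_sum fun c _ => Finset.sum_le_sum
        fun c' hmem => h i c c' (Finset.mem_filter.1 hmem).2

/-- Markov inequality for the rows of a finite relation. -/
theorem card_rows_gt_mul_le {α β : Type*} [Fintype α] [Fintype β] (B : Finset (α × β))
    (s : ℕ) [DecidableEq α] [DecidableEq β] :
    (Finset.univ.filter fun x : α => s < (Finset.univ.filter fun j => (x, j) ∈ B).card).card *
      (s + 1) ≤ B.card := by
  calc _ ≤ ∑ x ∈ Finset.univ.filter fun x : α => s < (Finset.univ.filter fun j => (x, j) ∈ B).card,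
        (Finset.univ.filter fun j => (x, j) ∈ B).card := by
        rw [← smul_eq_mul]
        refine Finset.card_nsmul_le_sum _ _ _ fun x hx => ?_
        simpa using hx
    _ ≤ ∑ x, (Finset.univ.filter fun j => (x, j) ∈ B).card :=
        Finset.sum_le_sum_of_subset (Finset.subset_univ _)
    _ ≤ B.card := sum_card_filter_mem_le (α := fun _ => β) (fun x j => (x, j))
        (by rintro ⟨x, j⟩ ⟨x', j'⟩ h; simpa using h) B

/-! ### Robustness of the tree of connectors. -/

namespace Layout

variable {δ : ℕ} (L : Layout δ)

set_option maxHeartbeats 1000000 in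
/-- After the deletion of `S`, every leaf `x` has a label `t x` such that labels increase from leaf
to leaf wherever the two leaves part at a level that is not bad for either of them; few pairs of a
leaf and a level are bad. -/
theorem exists_leaf_label (S : Finset L.Vertex) (l : L.Vertex → ℕ) (d : ℕ)
    (hd : ∀ v, v ∉ S → l v < d) (hl : ∀ u v, u ∉ S → v ∉ S → L.Edge u v → l u < l v) :
    ∃ (t : Fin L.size → ℕ) (B : Finset (Fin L.size × Fin L.height)),
      (∀ x, t x ≤ d) ∧ B.card ≤ 12 * S.card ∧
      ∀ x y j, L.Sib (L.child x j) (L.child y j) → (x, j) ∉ B → (y, j) ∉ B → t x < t y := by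
  classical
  -- thresholds at the leaves
  have hhub : ∀ x : Fin L.size, ∃ t ≤ d,
      (Finset.univ.filter fun j => .entry x (L.hub.port j) ∉ S ∧
        t ≤ l (.entry x (L.hub.port j))).card ≤
          (Finset.univ.filter fun a => Vertex.entry x a ∈ S).card +
          (Finset.univ.filter fun a => Vertex.exit x a ∈ S).card ∧
      (Finset.univ.filter fun j => .exit x (L.hub.port j) ∉ S ∧
        l (.exit x (L.hub.port j)) < t).card ≤
          (Finset.univ.filter fun a => Vertex.entry x a ∈ S).card +
          (Finset.univ.filter fun a => Vertex.exit x a ∈ S).card := by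
    intro x
    obtain ⟨t, htd, h1, h2⟩ := L.hub.exists_threshold
      (Finset.univ.filter fun a => Vertex.entry x a ∈ S)
      (Finset.univ.filter fun a => Vertex.exit x a ∈ S)
      (fun a => l (.entry x a)) (fun a => l (.exit x a)) d
      (fun a ha => hd _ (by simpa using ha))
      (fun a b ha hb h => hl _ _ (by simpa using ha) (by simpa using hb) (.entryUp x a b h))
      (fun a b ha hb h => hl _ _ (by simpa using hb) (by simpa using ha) (.exitDown x a b h))
      (fun a b ha hb h => hl _ _ (by simpa using ha) (by simpa using hb) (.through x a b h))
    -- Each leaf has just one pair of hubs, so the gain `base` is not needed here.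
    refine ⟨t, htd, (Nat.le_mul_of_pos_left _ L.base_pos).trans ?_,
      (Nat.le_mul_of_pos_left _ L.base_pos).trans ?_⟩
    · simpa using h1
    · simpa using h2
  choose t htd ht1 ht2 using hhub
  -- thresholds between sibling blocks
  have hblock : ∀ (j : Fin L.height) (c c' : Fin (L.size / L.base ^ (j : ℕ))), ∃ τ, L.Sib c c' →
      L.base * (Finset.univ.filter fun o => .out j c ((L.block j).port o) ∉ S ∧
        τ ≤ l (.out j c ((L.block j).port o))).card ≤
          (Finset.univ.filter fun a => Vertex.out j c a ∈ S).card +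
          (Finset.univ.filter fun a => Vertex.inn j c' a ∈ S).card ∧
      L.base * (Finset.univ.filter fun o => .inn j c' ((L.block j).port o) ∉ S ∧
        l (.inn j c' ((L.block j).port o)) < τ).card ≤
          (Finset.univ.filter fun a => Vertex.out j c a ∈ S).card +
          (Finset.univ.filter fun a => Vertex.inn j c' a ∈ S).card := by
    intro j c c'
    by_cases hs : L.Sib c c'
    · obtain ⟨τ, -, h1, h2⟩ := (L.block j).exists_threshold
        (Finset.univ.filter fun a => Vertex.out j c a ∈ S)
        (Finset.univ.filter fun a => Vertex.inn j c' a ∈ S)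
        (fun a => l (.out j c a)) (fun a => l (.inn j c' a)) d
        (fun a ha => hd _ (by simpa using ha))
        (fun a b ha hb h => hl _ _ (by simpa using ha) (by simpa using hb) (.outUp j c a b h))
        (fun a b ha hb h => hl _ _ (by simpa using hb) (by simpa using ha) (.inDown j c' a b h))
        (fun a b ha hb h => hl _ _ (by simpa using ha) (by simpa using hb) (.cross j c c' a b hs h))
      refine ⟨τ, fun _ => ⟨?_, ?_⟩⟩
      · simpa using h1
      · simpa using h2
    · exact ⟨0, fun h => (hs h).elim⟩
  choose τ hτ using hblock
  -- the vertices of `S` in the individual connectors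
  have hsum_entry : ∑ x, (Finset.univ.filter fun a => Vertex.entry (L := L) x a ∈ S).card ≤ S.card :=
    sum_card_filter_mem_le (α := fun _ => L.hub.carrier) (fun x a => Vertex.entry (L := L) x a)
      (by rintro ⟨x, a⟩ ⟨x', a'⟩ h; simpa using h) S
  have hsum_exit : ∑ x, (Finset.univ.filter fun a => Vertex.exit (L := L) x a ∈ S).card ≤ S.card :=
    sum_card_filter_mem_le (α := fun _ => L.hub.carrier) (fun x a => Vertex.exit (L := L) x a)
      (by rintro ⟨x, a⟩ ⟨x', a'⟩ h; simpa using h) S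
  have hsum_out : ∑ j, ∑ c, (Finset.univ.filter fun a => Vertex.out (L := L) j c a ∈ S).card ≤
      S.card := by
    rw [← Fintype.sum_sigma' (f := fun j c =>
      (Finset.univ.filter fun a => Vertex.out (L := L) j c a ∈ S).card)]
    refine sum_card_filter_mem_le (α := fun p : (Σ j : Fin L.height,
      Fin (L.size / L.base ^ (j : ℕ))) => (L.block p.1).carrier)
      (fun p a => Vertex.out (L := L) p.1 p.2 a) ?_ S
    rintro ⟨⟨j, c⟩, a⟩ ⟨⟨j', c'⟩, a'⟩ h
    cases h
    rfl
  have hsum_inn : ∑ j, ∑ c, (Finset.univ.filter fun a => Vertex.inn (L := L) j c a ∈ S).card ≤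
      S.card := by
    rw [← Fintype.sum_sigma' (f := fun j c =>
      (Finset.univ.filter fun a => Vertex.inn (L := L) j c a ∈ S).card)]
    refine sum_card_filter_mem_le (α := fun p : (Σ j : Fin L.height,
      Fin (L.size / L.base ^ (j : ℕ))) => (L.block p.1).carrier)
      (fun p a => Vertex.inn (L := L) p.1 p.2 a) ?_ S
    rintro ⟨⟨j, c⟩, a⟩ ⟨⟨j', c'⟩, a'⟩ h
    cases h
    rfl
  -- Each copy occurs in at most `base` sibling pairs, so the deletions are counted at most `base`
  -- times on either side.
  have hsum_sib : ∑ j, ∑ c, ∑ c' ∈ Finset.univ.filter (L.Sib c),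
      ((Finset.univ.filter fun a => Vertex.out (L := L) j c a ∈ S).card +
        (Finset.univ.filter fun a => Vertex.inn (L := L) j c' a ∈ S).card) ≤
      L.base * (2 * S.card) := by
    have hcardr : ∀ {M : ℕ} (c : Fin M), (Finset.univ.filter (L.Sib c)).card ≤ L.base := fun c =>
      (Finset.card_le_card (Finset.monotone_filter_right _ fun _ _ h => h.2.symm)).trans
        (L.card_same_parent_le c)
    have hcardl : ∀ {M : ℕ} (c' : Fin M),
        (Finset.univ.filter fun c => L.Sib c c').card ≤ L.base := fun c' =>
      (Finset.card_le_card (Finset.monotone_filter_right _ fun _ _ h => h.2)).trans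
        (L.card_same_parent_le c')
    simp only [Finset.sum_add_distrib]
    have e1 : ∑ j, ∑ c, ∑ _c' ∈ Finset.univ.filter (L.Sib c),
        (Finset.univ.filter fun a => Vertex.out (L := L) j c a ∈ S).card ≤ L.base * S.card := by
      calc _ ≤ ∑ j, ∑ c, L.base *
            (Finset.univ.filter fun a => Vertex.out (L := L) j c a ∈ S).card := by
            refine Finset.sum_le_sum fun j _ => Finset.sum_le_sum fun c _ => ?_
            rw [Finset.sum_const, smul_eq_mul]
            exact Nat.mul_le_mul_right _ (hcardr c)
        _ = L.base * ∑ j, ∑ c,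
            (Finset.univ.filter fun a => Vertex.out (L := L) j c a ∈ S).card := by
            simp only [Finset.mul_sum]
        _ ≤ _ := Nat.mul_le_mul_left _ hsum_out
    have e2 : ∑ j, ∑ c, ∑ c' ∈ Finset.univ.filter (L.Sib c),
        (Finset.univ.filter fun a => Vertex.inn (L := L) j c' a ∈ S).card ≤ L.base * S.card := by
      calc _ ≤ ∑ j, ∑ c, L.base *
            (Finset.univ.filter fun a => Vertex.inn (L := L) j c a ∈ S).card := by
            refine Finset.sum_le_sum fun j _ => ?_
            simp only [Finset.sum_filter]
            rw [Finset.sum_comm]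
            refine Finset.sum_le_sum fun c' _ => ?_
            rw [← Finset.sum_filter, Finset.sum_const, smul_eq_mul]
            exact Nat.mul_le_mul_right _ (hcardl c')
        _ = L.base * ∑ j, ∑ c,
            (Finset.univ.filter fun a => Vertex.inn (L := L) j c a ∈ S).card := by
            simp only [Finset.mul_sum]
        _ ≤ _ := Nat.mul_le_mul_left _ hsum_inn
    linarith
  -- the bad pairs
  let outp : Fin L.size × Fin L.height → L.Vertex := fun p =>
    .out p.2 (L.child p.1 p.2) ((L.block p.2).port (L.offset p.1 p.2))
  let innp : Fin L.size × Fin L.height → L.Vertex := fun p =>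
    .inn p.2 (L.child p.1 p.2) ((L.block p.2).port (L.offset p.1 p.2))
  let entp : Fin L.size × Fin L.height → L.Vertex := fun p => .entry p.1 (L.hub.port p.2)
  let extp : Fin L.size × Fin L.height → L.Vertex := fun p => .exit p.1 (L.hub.port p.2)
  have dead : ∀ φ : Fin L.size × Fin L.height → L.Vertex, Function.Injective φ →
      (Finset.univ.filter fun p => φ p ∈ S).card ≤ S.card := fun φ hφ =>
    Finset.card_le_card_of_injOn φ (fun p hp => by simpa using hp) hφ.injOn
  have hoffset : ∀ (j : Fin L.height) (c : Fin (L.size / L.base ^ (j : ℕ)))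
      (P : Fin (L.base ^ (j : ℕ)) → Prop),
      (Finset.univ.filter fun x => L.child x j = c ∧ P (L.offset x j)).card ≤
        (Finset.univ.filter P).card := by
    intro j c P
    refine Finset.card_le_card_of_injOn (fun x => L.offset x j) ?_ ?_
    · intro x hx
      simp only [Finset.coe_filter, Finset.mem_univ, true_and, Set.mem_ofPred_eq] at hx ⊢
      exact hx.2
    · intro x hx y hy hxy
      simp only [Finset.coe_filter, Finset.mem_univ, true_and, Set.mem_ofPred_eq] at hx hy
      exact L.leaf_ext (hx.1.trans hy.1.symm) hxy
  let D₁ := Finset.univ.filter fun p => outp p ∈ S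
  let D₂ := Finset.univ.filter fun p => innp p ∈ S
  let D₃ := Finset.univ.filter fun p => entp p ∈ S
  let D₄ := Finset.univ.filter fun p => extp p ∈ S
  have hD₁ : D₁.card ≤ S.card := by
    refine dead outp ?_
    rintro ⟨x, j⟩ ⟨y, i⟩ h
    simp only [outp, Vertex.out.injEq] at h
    obtain ⟨rfl, hc, ho⟩ := h
    rw [L.leaf_ext (eq_of_heq hc) ((L.block j).port_injective (eq_of_heq ho))]
  have hD₂ : D₂.card ≤ S.card := by
    refine dead innp ?_
    rintro ⟨x, j⟩ ⟨y, i⟩ h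
    simp only [innp, Vertex.inn.injEq] at h
    obtain ⟨rfl, hc, ho⟩ := h
    rw [L.leaf_ext (eq_of_heq hc) ((L.block j).port_injective (eq_of_heq ho))]
  have hD₃ : D₃.card ≤ S.card := by
    refine dead entp ?_
    rintro ⟨x, j⟩ ⟨y, i⟩ h
    simp only [entp, Vertex.entry.injEq] at h
    exact Prod.ext h.1 (L.hub.port_injective h.2)
  have hD₄ : D₄.card ≤ S.card := by
    refine dead extp ?_
    rintro ⟨x, j⟩ ⟨y, i⟩ h
    simp only [extp, Vertex.exit.injEq] at h
    exact Prod.ext h.1 (L.hub.port_injective h.2)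
  let H₁ := Finset.univ.biUnion fun x : Fin L.size => (Finset.univ.filter fun j =>
    .entry x (L.hub.port j) ∉ S ∧ t x ≤ l (.entry x (L.hub.port j))).image fun j => (x, j)
  let H₂ := Finset.univ.biUnion fun x : Fin L.size => (Finset.univ.filter fun j =>
    .exit x (L.hub.port j) ∉ S ∧ l (.exit x (L.hub.port j)) < t x).image fun j => (x, j)
  have hH₁ : H₁.card ≤ 2 * S.card := by
    refine Finset.card_biUnion_le.trans ((Finset.sum_le_sum fun x _ =>
      Finset.card_image_le.trans (ht1 x)).trans ?_)
    rw [Finset.sum_add_distrib]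
    omega
  have hH₂ : H₂.card ≤ 2 * S.card := by
    refine Finset.card_biUnion_le.trans ((Finset.sum_le_sum fun x _ =>
      Finset.card_image_le.trans (ht2 x)).trans ?_)
    rw [Finset.sum_add_distrib]
    omega
  let B₁ := Finset.univ.biUnion fun j : Fin L.height => Finset.univ.biUnion fun c =>
    (Finset.univ.filter (L.Sib c)).biUnion fun c' =>
      (Finset.univ.filter fun x => L.child x j = c ∧
        (.out j c ((L.block j).port (L.offset x j)) ∉ S ∧
          τ j c c' ≤ l (.out j c ((L.block j).port (L.offset x j))))).image fun x => (x, j)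
  let B₂ := Finset.univ.biUnion fun j : Fin L.height => Finset.univ.biUnion fun c =>
    (Finset.univ.filter (L.Sib c)).biUnion fun c' =>
      (Finset.univ.filter fun x => L.child x j = c' ∧
        (.inn j c' ((L.block j).port (L.offset x j)) ∉ S ∧
          l (.inn j c' ((L.block j).port (L.offset x j))) < τ j c c')).image fun x => (x, j)
  have hB₁ : B₁.card ≤ 2 * S.card := by
    refine Nat.le_of_mul_le_mul_left (le_trans ?_ hsum_sib) L.base_pos
    refine mul_card_biUnion_le (fun j => L.Sib) _ _ L.base fun j c c' hc' => ?_
    refine (Nat.mul_le_mul_left _ Finset.card_image_le).trans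
      ((Nat.mul_le_mul_left _ ?_).trans (hτ j c c' hc').1)
    convert hoffset j c (fun o => .out j c ((L.block j).port o) ∉ S ∧
      τ j c c' ≤ l (.out j c ((L.block j).port o)))
  have hB₂ : B₂.card ≤ 2 * S.card := by
    refine Nat.le_of_mul_le_mul_left (le_trans ?_ hsum_sib) L.base_pos
    refine mul_card_biUnion_le (fun j => L.Sib) _ _ L.base fun j c c' hc' => ?_
    refine (Nat.mul_le_mul_left _ Finset.card_image_le).trans
      ((Nat.mul_le_mul_left _ ?_).trans (hτ j c c' hc').2)
    convert hoffset j c' (fun o => .inn j c' ((L.block j).port o) ∉ S ∧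
      l (.inn j c' ((L.block j).port o)) < τ j c c')
  -- A pair is bad if one of its four ports is dead (`4 * |S|` in all), or a live port lies on the
  -- wrong side of a hub threshold (`4 * |S|`) or of a block threshold (`4 * |S|`).
  refine ⟨t, (D₁ ∪ D₂) ∪ (D₃ ∪ D₄) ∪ ((H₁ ∪ H₂) ∪ (B₁ ∪ B₂)), htd, ?_, ?_⟩
  · have h1 := Finset.card_union_le ((D₁ ∪ D₂) ∪ (D₃ ∪ D₄)) ((H₁ ∪ H₂) ∪ (B₁ ∪ B₂))
    have h2 := Finset.card_union_le (D₁ ∪ D₂) (D₃ ∪ D₄)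
    have h3 := Finset.card_union_le (H₁ ∪ H₂) (B₁ ∪ B₂)
    have h4 := Finset.card_union_le D₁ D₂
    have h5 := Finset.card_union_le D₃ D₄
    have h6 := Finset.card_union_le H₁ H₂
    have h7 := Finset.card_union_le B₁ B₂
    omega
  · intro x y j hs hx hy
    simp only [Finset.mem_union, not_or] at hx hy
    have ax1 : outp (x, j) ∉ S := fun h => hx.1.1.1 (Finset.mem_filter.2 ⟨Finset.mem_univ _, h⟩)
    have ax4 : extp (x, j) ∉ S := fun h => hx.1.2.2 (Finset.mem_filter.2 ⟨Finset.mem_univ _, h⟩)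
    have ay2 : innp (y, j) ∉ S := fun h => hy.1.1.2 (Finset.mem_filter.2 ⟨Finset.mem_univ _, h⟩)
    have ay3 : entp (y, j) ∉ S := fun h => hy.1.2.1 (Finset.mem_filter.2 ⟨Finset.mem_univ _, h⟩)
    -- The labels climb along the route: `t x ≤ exit < out < τ ≤ inn < entry < t y`.
    have c1 : t x ≤ l (extp (x, j)) := by
      by_contra hcon
      refine hx.2.1.2 (Finset.mem_biUnion.2 ⟨x, Finset.mem_univ _, Finset.mem_image_of_mem _ ?_⟩)
      exact Finset.mem_filter.2 ⟨Finset.mem_univ _, ax4, not_le.1 hcon⟩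
    have c2 : l (extp (x, j)) < l (outp (x, j)) := hl _ _ ax4 ax1 (.leave x j)
    have c3 : l (outp (x, j)) < τ j (L.child x j) (L.child y j) := by
      by_contra hcon
      refine hx.2.2.1 (Finset.mem_biUnion.2 ⟨j, Finset.mem_univ _, Finset.mem_biUnion.2
        ⟨L.child x j, Finset.mem_univ _, Finset.mem_biUnion.2 ⟨L.child y j,
          Finset.mem_filter.2 ⟨Finset.mem_univ _, hs⟩, Finset.mem_image.2 ⟨x, ?_, rfl⟩⟩⟩⟩)
      exact Finset.mem_filter.2 ⟨Finset.mem_univ _, rfl, ax1, not_lt.1 hcon⟩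
    have c4 : τ j (L.child x j) (L.child y j) ≤ l (innp (y, j)) := by
      by_contra hcon
      refine hy.2.2.2 (Finset.mem_biUnion.2 ⟨j, Finset.mem_univ _, Finset.mem_biUnion.2
        ⟨L.child x j, Finset.mem_univ _, Finset.mem_biUnion.2 ⟨L.child y j,
          Finset.mem_filter.2 ⟨Finset.mem_univ _, hs⟩, Finset.mem_image.2 ⟨y, ?_, rfl⟩⟩⟩⟩)
      exact Finset.mem_filter.2 ⟨Finset.mem_univ _, rfl, ay2, not_le.1 hcon⟩
    have c5 : l (innp (y, j)) < l (entp (y, j)) := hl _ _ ay2 ay3 (.enter y j)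
    have c6 : l (entp (y, j)) < t y := by
      by_contra hcon
      refine hy.2.1.1 (Finset.mem_biUnion.2 ⟨y, Finset.mem_univ _, Finset.mem_image_of_mem _ ?_⟩)
      exact Finset.mem_filter.2 ⟨Finset.mem_univ _, ay3, not_lt.1 hcon⟩
    omega

/-- The digit of the leaf `x` at level `j`. -/
def digit (x : Fin L.size) (j : Fin L.height) : Fin L.base :=
  ⟨(x : ℕ) / L.base ^ (j : ℕ) % L.base, Nat.mod_lt _ L.base_pos⟩

/-- The level lies one below the least exponent at which the quotients of `x` and `y` coincide. -/
theorem exists_sib {x y : Fin L.size} (hxy : x < y) :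
    ∃ j, L.Sib (L.child x j) (L.child y j) ∧ L.digit x j ≠ L.digit y j := by
  classical
  have hex : ∃ i, (x : ℕ) / L.base ^ i = (y : ℕ) / L.base ^ i :=
    ⟨L.height, by rw [Nat.div_eq_of_lt (x.2.trans_le L.size_le),
      Nat.div_eq_of_lt (y.2.trans_le L.size_le)]⟩
  have hle : Nat.find hex ≤ L.height := Nat.find_min' hex (by
    rw [Nat.div_eq_of_lt (x.2.trans_le L.size_le), Nat.div_eq_of_lt (y.2.trans_le L.size_le)])
  obtain ⟨i, hi⟩ : ∃ i, Nat.find hex = i + 1 := by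
    refine Nat.exists_eq_succ_of_ne_zero fun h0 => ?_
    have := Nat.find_spec hex
    rw [h0] at this
    simp only [pow_zero, Nat.div_one] at this
    exact hxy.ne (Fin.ext this)
  have hspec : (x : ℕ) / L.base ^ i / L.base = (y : ℕ) / L.base ^ i / L.base := by
    have := Nat.find_spec hex
    rw [hi] at this
    rwa [Nat.div_div_eq_div_mul, Nat.div_div_eq_div_mul, ← pow_succ]
  have hne : (x : ℕ) / L.base ^ i ≠ (y : ℕ) / L.base ^ i := Nat.find_min hex (by omega)
  refine ⟨⟨i, by omega⟩, ⟨?_, hspec⟩, fun h => hne ?_⟩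
  · exact lt_of_le_of_ne (Nat.div_le_div_right hxy.le) (fun h => hne (congrArg Fin.val h))
  · have h1 := congrArg Fin.val h
    simp only [digit] at h1
    rw [← Nat.div_add_mod ((x : ℕ) / L.base ^ i) L.base, hspec, h1, Nat.div_add_mod]

/-- After the deletion of few vertices a long path remains. -/
theorem containsPath (S : Finset L.Vertex) (s d : ℕ)
    (hS : 24 * S.card ≤ (s + 1) * L.size)
    (hd : 2 * ((d + 1) * (L.height * L.base + 1) ^ s) < L.size) :
    ContainsPath (deleteNodes L.graph S) d := by
  classical
  by_contra hcon
  obtain ⟨l, hld, hl⟩ := exists_label (L.isAcyclic.deleteNodes S) hcon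
  obtain ⟨t, B, htd, hB, ht⟩ := L.exists_leaf_label S
    -- The value 0 on deleted vertices is arbitrary: labels matter only off `S`.
    (fun v => if hv : v ∈ S then 0 else l ⟨v, hv⟩) d
    (fun v hv => by simpa [hv] using hld ⟨v, hv⟩)
    (fun u v hu hv h => by simpa [hu, hv] using hl ⟨u, hu⟩ ⟨v, hv⟩ h)
  let bad : Fin L.size → Finset (Fin L.height) := fun x => Finset.univ.filter fun j => (x, j) ∈ B
  -- Recording digits, not just levels, is what matters: equal signatures force equal digits at
  -- every bad level, so the level where two such leaves part is good for both.
  let sig : Fin L.size → Finset (Fin L.height × Fin L.base) := fun x =>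
    (bad x).image fun j => (j, L.digit x j)
  have hmark := card_rows_gt_mul_le B s
  have hsplit := Finset.card_filter_add_card_filter_not (s := (Finset.univ : Finset (Fin L.size)))
    (fun x => s < (bad x).card)
  rw [Finset.card_univ, Fintype.card_fin] at hsplit
  -- Here `24 = 2 * 12`: at most half of the leaves have more than `s` bad levels.
  have hfew : 2 * (Finset.univ.filter fun x => s < (bad x).card).card ≤ L.size := by
    refine Nat.le_of_mul_le_mul_right ?_ (Nat.succ_pos s)
    calc _ = 2 * ((Finset.univ.filter fun x => s < (bad x).card).card * (s + 1)) := by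
          rw [Nat.succ_eq_add_one]; ring
      _ ≤ 2 * B.card := Nat.mul_le_mul_left _ hmark
      _ ≤ 24 * S.card := by omega
      _ ≤ _ := by rw [Nat.succ_eq_add_one, mul_comm L.size]; exact hS
  have hmany : (Finset.univ.filter fun x => ¬ s < (bad x).card).card ≤
      (d + 1) * (L.height * L.base + 1) ^ s := by
    calc _ ≤ (Finset.range (d + 1) ×ˢ
          Finset.univ.filter fun W : Finset (Fin L.height × Fin L.base) => W.card ≤ s).card := by
          refine Finset.card_le_card_of_injOn (fun x => (t x, sig x)) ?_ ?_
          · intro x hx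
            simp only [Finset.coe_filter, Finset.mem_univ, true_and, Set.mem_ofPred_eq,
              not_lt] at hx
            simp only [Finset.coe_product, Set.mem_prod, Finset.mem_coe, Finset.mem_range,
              Finset.mem_filter, Finset.mem_univ, true_and]
            exact ⟨Nat.lt_succ_of_le (htd x), Finset.card_image_le.trans hx⟩
          · have key : ∀ x y, x < y → sig x = sig y → t x < t y := by
              intro x y hxy hsig
              obtain ⟨j, hsib, hdig⟩ := L.exists_sib hxy
              refine ht x y j hsib (fun hj => hdig ?_) (fun hj => hdig ?_)
              · have : (j, L.digit x j) ∈ sig y := by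
                  rw [← hsig]
                  exact Finset.mem_image.2 ⟨j, Finset.mem_filter.2 ⟨Finset.mem_univ _, hj⟩, rfl⟩
                obtain ⟨i, -, hi⟩ := Finset.mem_image.1 this
                obtain ⟨rfl, h⟩ := Prod.mk.inj hi
                exact h.symm
              · have : (j, L.digit y j) ∈ sig x := by
                  rw [hsig]
                  exact Finset.mem_image.2 ⟨j, Finset.mem_filter.2 ⟨Finset.mem_univ _, hj⟩, rfl⟩
                obtain ⟨i, -, hi⟩ := Finset.mem_image.1 this
                obtain ⟨rfl, h⟩ := Prod.mk.inj hi
                exact h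
            intro x _ y _ hxy
            obtain ⟨h1, h2⟩ := Prod.mk.inj hxy
            rcases lt_trichotomy x y with h | h | h
            · exact absurd h1 (key x y h h2).ne
            · exact h
            · exact absurd h1 (key y x h h2.symm).ne'
      _ ≤ _ := by
        rw [Finset.card_product, Finset.card_range]
        refine Nat.mul_le_mul_left _ ((card_filter_card_le _ s).trans ?_)
        simp
  omega

end Layout

/-! ### Passage to `Fin M` and the choice of parameters. -/

/-- Transport of a digraph along an enumeration of its vertices. -/
theorem exists_digraph_fin {V : Type*} [Fintype V] {G : Digraph V} {δ : ℕ} (hG : IsAcyclic G)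
    (hδ : IndegreeLE G δ) : ∃ G' : Digraph (Fin (Fintype.card V)), IsAcyclic G' ∧
      IndegreeLE G' δ ∧ ∀ S' : Finset (Fin (Fintype.card V)), ∃ S : Finset V, S.card = S'.card ∧
        ∀ d, ContainsPath (deleteNodes G S) d → ContainsPath (deleteNodes G' S') d := by
  classical
  let e := Fintype.equivFin V
  refine ⟨⟨fun u v => G.Adj (e.symm u) (e.symm v)⟩, fun v hv => ?_, fun v => ?_, fun S' => ?_⟩
  · exact hG _ (Relation.TransGen.lift e.symm (fun _ _ h => h) _ _ hv)
  · refine le_trans (le_of_eq ?_) (hδ (e.symm v))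
    have : {u | G.Adj u (e.symm v)} = e.symm '' {u | G.Adj (e.symm u) (e.symm v)} := by
      ext u
      constructor
      · intro h
        exact ⟨e u, by simpa using h, by simp⟩
      · rintro ⟨w, hw, rfl⟩
        exact hw
    rw [this, e.symm.injective.encard_image]
  · refine ⟨S'.map e.symm.toEmbedding, by simp, ?_⟩
    rintro d ⟨k, hk, p, hp, hadj⟩
    refine ⟨k, hk, fun i => ⟨e (p i).1, fun h => (p i).2 ?_⟩, ?_, ?_⟩
    · exact Finset.mem_map.2 ⟨_, h, by simp⟩
    · intro i j hij
      exact hp (Subtype.ext (e.injective (congrArg Subtype.val hij)))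
    · intro i
      simpa [deleteNodes] using hadj i

/-- Trees of connectors on `2 ^ n` leaves with base `2 ^ g`. -/
theorem exists_tree (g : ℕ) (hg : 0 < g) : ∃ δ : ℕ, ∀ n : ℕ, 0 < n →
    ∃ (M : ℕ) (G : Digraph (Fin M)), IsAcyclic G ∧ IndegreeLE G δ ∧
      2 ^ n * ((n - 1) / g + 1) ≤ M ∧ M ≤ 8 * (2 ^ n * ((n - 1) / g + 1)) ∧
      ∀ (S : Finset (Fin M)) (s d : ℕ), 24 * S.card ≤ (s + 1) * 2 ^ n →
        2 * ((d + 1) * (((n - 1) / g + 1) * 2 ^ g + 1) ^ s) < 2 ^ n →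
        ContainsPath (deleteNodes G S) d := by
  obtain ⟨δ, hδ⟩ := exists_connector (2 ^ g) (by positivity)
  refine ⟨2 ^ g * δ + 2 * δ + 1, fun n hn => ?_⟩
  have hdm := Nat.div_add_mod (n - 1) g
  have hml := Nat.mod_lt (n - 1) hg
  let L : Layout δ :=
    { base := 2 ^ g
      size := 2 ^ n
      -- This is `n / g` rounded up: `height` digits suffice for all leaves, and the smaller powers
      -- of the base still divide `2 ^ n`.
      height := (n - 1) / g + 1
      base_pos := by positivity
      dvd := fun j => by
        rw [← pow_mul]
        refine pow_dvd_pow _ ?_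
        have h1 : (j : ℕ) ≤ (n - 1) / g := Nat.lt_succ_iff.1 j.2
        have h2 := Nat.mul_le_mul_left g h1
        omega
      size_le := by
        rw [← pow_mul]
        refine Nat.pow_le_pow_right (by norm_num) ?_
        rw [Nat.mul_add]
        omega
      block := fun j => (hδ _).some
      hub := (hδ _).some }
  obtain ⟨G, hacyc, hdeg, hpath⟩ := exists_digraph_fin L.isAcyclic L.predLE.indegreeLE
  refine ⟨_, G, hacyc, hdeg, L.le_card_vertex, L.card_vertex_le, fun S s d hS hd => ?_⟩
  obtain ⟨S₀, hS₀, h⟩ := hpath S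
  exact h d (L.containsPath S₀ s d (by rw [hS₀]; exact hS) hd)

theorem height_bounds {g n : ℕ} (hg : 0 < g) (hn : 0 < n) :
    (n : ℝ) / g ≤ ((n - 1) / g + 1 : ℕ) ∧ (((n - 1) / g + 1 : ℕ) : ℝ) ≤ n / g + 1 ∧
      (n - 1) / g + 1 ≤ n := by
  have hdm := Nat.div_add_mod (n - 1) g
  have hml := Nat.mod_lt (n - 1) hg
  have hg' : (0 : ℝ) < g := by exact_mod_cast hg
  refine ⟨?_, ?_, ?_⟩
  · rw [div_le_iff₀ hg']
    have h : n ≤ ((n - 1) / g + 1) * g := by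
      have : ((n - 1) / g + 1) * g = g * ((n - 1) / g) + g := by ring
      omega
    exact_mod_cast h
  · push_cast
    gcongr
    rw [le_div_iff₀ hg']
    have h : (n - 1) / g * g ≤ n := (Nat.div_mul_le_self _ _).trans (by omega)
    exact_mod_cast h
  · have := Nat.div_le_self (n - 1) g
    omega

theorem eventually_sq_logb_le : ∃ n₀ : ℕ, ∀ n : ℕ, n₀ ≤ n → Real.logb 2 n ^ 2 ≤ n := by
  have h := (Real.isLittleO_pow_log_id_atTop (n := 2)).bound
    (show (0 : ℝ) < Real.log 2 ^ 2 by have := Real.log_pos one_lt_two; positivity)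
  obtain ⟨n₀, hn₀⟩ := Filter.eventually_atTop.1 (tendsto_natCast_atTop_atTop.eventually h)
  refine ⟨n₀, fun n hn => ?_⟩
  have h1 := hn₀ n hn
  have h2 : (0 : ℝ) < Real.log 2 ^ 2 := by have := Real.log_pos one_lt_two; positivity
  simp only [id, Real.norm_eq_abs, abs_pow, sq_abs, Nat.abs_cast] at h1
  rw [Real.logb, div_pow, div_le_iff₀ h2]
  linarith

/-- The tangent to the logarithm at 4, where equality holds. -/
theorem logb_le_half {x : ℝ} (hx : 4 ≤ x) : Real.logb 2 x ≤ x / 2 := by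
  have hl2 : (1 : ℝ) / 2 < Real.log 2 := by have := Real.log_two_gt_d9; linarith
  have h1 := Real.log_le_sub_one_of_pos (show 0 < x / 4 by linarith)
  rw [Real.log_div (by linarith) (by norm_num), show (4 : ℝ) = 2 ^ 2 by norm_num,
    Real.log_pow] at h1
  rw [Real.logb, div_le_iff₀ (by linarith)]
  push_cast at h1
  nlinarith

/-- The transitive tournament is robust enough for a bounded number of vertices. -/
theorem tournament_robust {m : ℕ} (hm : 16 ≤ m) :
    IsDepthRobust (tournament m) (m * Real.logb 2 (Real.logb 2 m) / Real.logb 2 m)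
      (m / Real.logb 2 m ^ (1 + Real.logb 2 (Real.logb 2 m))) := by
  have hm' : (16 : ℝ) ≤ m := by exact_mod_cast hm
  have hL : 4 ≤ Real.logb 2 m := by
    rw [Real.le_logb_iff_rpow_le one_lt_two (by linarith)]
    norm_num
    linarith
  set x := Real.logb 2 m with hx
  have hlog : 0 ≤ Real.logb 2 x := Real.logb_nonneg one_lt_two (by linarith)
  have h1 : (m : ℝ) * Real.logb 2 x / x ≤ m / 2 := by
    rw [div_le_iff₀ (by linarith)]
    have := logb_le_half hL
    nlinarith
  have hpow : 4 ≤ x ^ (1 + Real.logb 2 x) := by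
    calc (4 : ℝ) ≤ x ^ (1 : ℝ) := by simpa using hL
      _ ≤ _ := Real.rpow_le_rpow_of_exponent_le (by linarith) (by linarith)
  have h2 : (m : ℝ) / x ^ (1 + Real.logb 2 x) ≤ m / 4 := by gcongr
  exact tournament_isDepthRobust (by linarith) (by positivity)

-- With `ℓ = log n`, about `ℓ / 4` bad levels are allowed. There are then at most `y = 2 ^ (ℓ ^ 2 /
-- 2)` signatures, whereas the required depth is at most `2 ^ n / y ^ 2`.
set_option maxHeartbeats 1000000 in
theorem parameters_of_few_deletions (g : ℕ) (hg : 3072 ≤ g) : ∃ n₀ : ℕ, ∀ n : ℕ, n₀ ≤ n →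
    ∀ M : ℕ, 2 ^ n * ((n - 1) / g + 1) ≤ M → M ≤ 8 * (2 ^ n * ((n - 1) / g + 1)) →
    ∀ k : ℕ, (k : ℝ) ≤ M * Real.logb 2 (Real.logb 2 M) / Real.logb 2 M →
    ∃ s d : ℕ, 24 * k ≤ (s + 1) * 2 ^ n ∧
      2 * ((d + 1) * (((n - 1) / g + 1) * 2 ^ g + 1) ^ s) < 2 ^ n ∧
      M / Real.logb 2 M ^ (1 + Real.logb 2 (Real.logb 2 M)) ≤ (d : ℝ) := by
  obtain ⟨n₁, hn₁⟩ := eventually_sq_logb_le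
  refine ⟨n₁ + g + 2 ^ g + 16, fun n hn M hM1 hM2 k hk => ?_⟩
  have hpow0 : 0 < 2 ^ g := by positivity
  have hn16' : 16 ≤ n := by omega
  have hgn' : g ≤ n := by omega
  have hbn : 2 ^ g + 1 ≤ n := by omega
  have hsq := hn₁ n (by omega)
  clear hn
  have hg0 : 0 < g := by omega
  obtain ⟨-, hh2, hh3⟩ := height_bounds hg0 (show 0 < n by omega)
  set h := (n - 1) / g + 1 with hh
  set ℓ := Real.logb 2 n with hℓ
  set P : ℝ := 2 ^ n with hP
  have hP0 : 0 < P := by positivity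
  have hgr : (3072 : ℝ) ≤ g := by exact_mod_cast hg
  have hn16 : (16 : ℝ) ≤ n := by exact_mod_cast hn16'
  have hgn : (g : ℝ) ≤ n := by exact_mod_cast hgn'
  have hℓ4 : 4 ≤ ℓ := by
    rw [hℓ, Real.le_logb_iff_rpow_le one_lt_two (by linarith)]
    norm_num
    linarith
  have hh2' : (h : ℝ) ≤ 2 * n / g := by
    have : 1 ≤ (n : ℝ) / g := by rw [le_div_iff₀ (by linarith)]; linarith
    calc (h : ℝ) ≤ n / g + 1 := hh2
      _ ≤ n / g + n / g := by linarith
      _ = _ := by ring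
  have hM1' : P * h ≤ M := by rw [hP]; exact_mod_cast hM1
  have hM2' : (M : ℝ) ≤ 8 * (P * h) := by rw [hP]; exact_mod_cast hM2
  have hh1 : (1 : ℝ) ≤ h := by
    have : 1 ≤ h := Nat.succ_le_succ (Nat.zero_le _)
    exact_mod_cast this
  have hMP : P ≤ M := by nlinarith
  have hhn : 8 * (h : ℝ) ≤ n := by
    have : 2 * (n : ℝ) / g ≤ n / 8 := by
      rw [div_le_iff₀ (by linarith)]
      nlinarith
    linarith
  have hMn : (M : ℝ) ≤ P * n := by nlinarith
  have hlogP : Real.logb 2 P = n := by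
    rw [hP, ← Real.rpow_natCast, Real.logb_rpow (by norm_num) (by norm_num)]
  have hM0 : (0 : ℝ) < M := by linarith
  set L := Real.logb 2 M with hL
  have hLn : (n : ℝ) ≤ L := by
    rw [← hlogP]
    exact Real.logb_le_logb_of_le one_lt_two hP0 hMP
  have hnP : (n : ℝ) ≤ P := by
    rw [hP]
    exact_mod_cast (Nat.lt_two_pow_self (n := n)).le
  have hL2n : L ≤ 2 * n := by
    calc L ≤ Real.logb 2 (P * P) :=
          Real.logb_le_logb_of_le one_lt_two hM0 (by nlinarith)
      _ = 2 * n := by rw [Real.logb_mul hP0.ne' hP0.ne', hlogP]; ring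
  have hlogL1 : ℓ ≤ Real.logb 2 L :=
    Real.logb_le_logb_of_le one_lt_two (by linarith) hLn
  have hlogL2 : Real.logb 2 L ≤ 2 * ℓ := by
    calc Real.logb 2 L ≤ Real.logb 2 (2 * n) :=
          Real.logb_le_logb_of_le one_lt_two (by linarith) hL2n
      _ = 1 + ℓ := by
          rw [Real.logb_mul (by norm_num) (by linarith), Real.logb_self_eq_one one_lt_two]
      _ ≤ 2 * ℓ := by linarith
  -- the number of bad levels
  have hkP : 24 * (k : ℝ) ≤ ℓ / 4 * P := by
    have e1 : (M : ℝ) * Real.logb 2 L / L ≤ 8 * (P * (2 * n / g)) * (2 * ℓ) / n := by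
      have e0 : 0 ≤ Real.logb 2 L := by linarith
      gcongr
      exact hM2'.trans (by gcongr)
    have e2 : 8 * (P * (2 * n / g)) * (2 * ℓ) / n = 32 * P * ℓ / g := by
      field_simp
      ring
    have e3 : 32 * P * ℓ / g ≤ 32 * P * ℓ / 3072 := by gcongr
    have e4 : 24 * (k : ℝ) ≤ 24 * (32 * P * ℓ / 3072) := by linarith
    calc _ ≤ _ := e4
      _ = _ := by ring
  have hs : ((⌊ℓ / 4⌋₊ : ℕ) : ℝ) ≤ ℓ / 4 := Nat.floor_le (by linarith)
  have hs' : ℓ / 4 < (⌊ℓ / 4⌋₊ : ℕ) + 1 := Nat.lt_floor_add_one _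
  set s := ⌊ℓ / 4⌋₊ with hsdef
  set y : ℝ := 2 ^ (ℓ ^ 2 / 2) with hy
  have hy8 : 8 ≤ y := by
    calc (8 : ℝ) = 2 ^ (3 : ℝ) := by norm_num
      _ ≤ y := Real.rpow_le_rpow_of_exponent_le one_le_two (by nlinarith)
  have hyP : 8 * y ≤ P := by
    calc 8 * y = 2 ^ (3 + ℓ ^ 2 / 2) := by rw [Real.rpow_add two_pos, hy]; norm_num
      _ ≤ 2 ^ (n : ℝ) := Real.rpow_le_rpow_of_exponent_le one_le_two (by nlinarith)
      _ = P := by rw [Real.rpow_natCast]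
  have hn2ℓ : (n : ℝ) = 2 ^ ℓ := (Real.rpow_logb two_pos (by norm_num) (by linarith)).symm
  have hpown : (n : ℝ) ^ ℓ = y * y := by
    rw [hn2ℓ, ← Real.rpow_mul two_pos.le, hy, ← Real.rpow_add two_pos]
    congr 1
    ring
  have hclass : (((h * 2 ^ g + 1) ^ s : ℕ) : ℝ) ≤ y := by
    have e1 : h * 2 ^ g + 1 ≤ n ^ 2 := by
      calc h * 2 ^ g + 1 ≤ n * 2 ^ g + n := by gcongr; omega
        _ = n * (2 ^ g + 1) := by ring
        _ ≤ n * n := Nat.mul_le_mul_left _ hbn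
        _ = n ^ 2 := (sq n).symm
    calc (((h * 2 ^ g + 1) ^ s : ℕ) : ℝ) ≤ ((n : ℝ) ^ 2) ^ s := by
          exact_mod_cast Nat.pow_le_pow_left e1 s
      _ = 2 ^ (2 * s * ℓ) := by
          rw [← pow_mul, ← Real.rpow_natCast, hn2ℓ, ← Real.rpow_mul two_pos.le]
          congr 1
          push_cast
          ring
      _ ≤ y := Real.rpow_le_rpow_of_exponent_le one_le_two (by nlinarith)
  have hdepth : M / L ^ (1 + Real.logb 2 L) ≤ P / (y * y) := by
    have e1 : (n : ℝ) * (y * y) ≤ L ^ (1 + Real.logb 2 L) := by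
      calc (n : ℝ) * (y * y) = (n : ℝ) ^ (1 + ℓ) := by
            rw [Real.rpow_add (by linarith), Real.rpow_one, hpown]
        _ ≤ L ^ (1 + ℓ) := Real.rpow_le_rpow (by linarith) hLn (by linarith)
        _ ≤ _ := Real.rpow_le_rpow_of_exponent_le (by linarith) (by linarith)
    calc M / L ^ (1 + Real.logb 2 L) ≤ P * n / (n * (y * y)) := by gcongr
      _ = _ := by field_simp
  refine ⟨s, ⌈P / (y * y)⌉₊, ?_, ?_, hdepth.trans (Nat.le_ceil _)⟩
  · have : (24 * k : ℝ) ≤ (s + 1) * 2 ^ n := by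
      rw [← hP]
      nlinarith
    exact_mod_cast this
  · have hceil : ((⌈P / (y * y)⌉₊ : ℕ) : ℝ) ≤ P / (y * y) + 1 :=
      (Nat.ceil_lt_add_one (by positivity)).le
    generalize ⌈P / (y * y)⌉₊ = D at hceil ⊢
    have : 2 * ((D + 1 : ℝ) * (((h * 2 ^ g + 1) ^ s : ℕ) : ℝ)) < P := by
      calc _ ≤ 2 * ((P / (y * y) + 1 + 1) * y) := by gcongr
        _ = 2 * (P / y) + 4 * y := by field_simp; ring
        _ ≤ 2 * (P / 8) + 4 * y := by gcongr
        _ < P := by linarith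
    rw [hP] at this
    exact_mod_cast this

/-- For `s ≥ 8` the last term is at least `(n / s) ^ s ≥ n ^ (s / 2)`, because `s ^ 2 ≤ n`; for
smaller `s` the term `n.choose 1` is enough. -/
theorem pow_le_sum_choose {n s : ℕ} (hs : 1 ≤ s) (hsn : s ^ 2 ≤ n) :
    n ^ (2 * (s / 8) + 1) ≤ ∑ j ∈ Finset.range (s + 1), n.choose j := by
  by_cases h8 : s < 8
  · rw [Nat.div_eq_of_lt h8]
    calc n ^ (2 * 0 + 1) = n.choose 1 := by simp
      _ ≤ _ := Finset.single_le_sum (fun _ _ => Nat.zero_le _) (Finset.mem_range.2 (by omega))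
  · refine le_trans ?_ (Finset.single_le_sum (f := fun j => n.choose j)
      (fun _ _ => Nat.zero_le _) (Finset.mem_range.2 (Nat.lt_succ_self s)))
    have hsn' : s ≤ n := by nlinarith
    have h1 := choose_mul_pow_le hsn' s
    rw [Nat.choose_self, one_mul] at h1
    refine Nat.le_of_mul_le_mul_right (le_trans ?_ h1) (pow_pos (by omega : 0 < s) s)
    have h2 : s = 2 * (2 * (s / 8) + 1) + (s - 2 * (2 * (s / 8) + 1)) := by omega
    set p := 2 * (s / 8) + 1 with hp
    calc n ^ p * s ^ s = n ^ p * (s ^ (2 * p) * s ^ (s - 2 * p)) := by rw [← pow_add, ← h2]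
      _ = n ^ p * ((s ^ 2) ^ p * s ^ (s - 2 * p)) := by rw [pow_mul]
      _ ≤ n ^ p * (n ^ p * n ^ (s - 2 * p)) := by gcongr
      _ = n ^ s := by
        rw [← pow_add, ← pow_add]
        congr 1
        omega

theorem parameters_of_few_bad_levels (g : ℕ) (hg : 0 < g) : ∃ n₀ : ℕ, ∀ n : ℕ, n₀ ≤ n →
    ∃ n₁ : ℕ, 0 < n₁ ∧ 8 * (2 ^ n₁ * ((n₁ - 1) / g + 1)) ≤ 4096 * 2 ^ n ∧
      ∀ s : ℕ, 1 ≤ s → (s : ℝ) ≤ Real.logb 2 n → ∀ k : ℕ, (k : ℝ) ≤ s * 2 ^ n / (2 * n) →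
      ∃ s' d : ℕ, 24 * k ≤ (s' + 1) * 2 ^ n₁ ∧
        2 * ((d + 1) * (((n₁ - 1) / g + 1) * 2 ^ g + 1) ^ s') < 2 ^ n₁ ∧
        2 ^ n / ∑ j ∈ Finset.range (s + 1), (n.choose j : ℝ) ≤ (d : ℝ) := by
  obtain ⟨m₀, hm₀⟩ := eventually_sq_logb_le
  refine ⟨m₀ + 2 * 2 ^ g + 16, fun n hn => ?_⟩
  have hsq := hm₀ n (by omega)
  have hn16 : 16 ≤ n := by omega
  set a := Nat.log 2 n with ha
  have ha1 : 2 ^ a ≤ n := Nat.pow_log_le_self 2 (by omega)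
  have ha2 : n < 2 ^ (a + 1) := Nat.lt_pow_succ_log_self (by norm_num) n
  have han : a < n := (Nat.lt_two_pow_self).trans_le ha1
  obtain ⟨-, -, hh3⟩ := height_bounds (n := n - a + 7) hg (by omega)
  -- The leaves number between `128 * 2 ^ n / n` and `256 * 2 ^ n / n`; dividing by about `n` makes
  -- up for the height, and 128 leaves room for the constants.
  set n₁ := n - a + 7 with hn₁
  set h := (n₁ - 1) / g + 1 with hh
  have hpow : 2 ^ n₁ * 2 ^ a = 128 * 2 ^ n := by
    rw [← pow_add, show n₁ + a = 7 + n by omega, pow_add]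
    norm_num
  have hh2n : h ≤ 2 * n := by omega
  have hbase : h * 2 ^ g + 1 ≤ n ^ 2 := by
    have : 2 * 2 ^ g + 1 ≤ n := by omega
    nlinarith
  refine ⟨n₁, by omega, ?_, ?_⟩
  · refine Nat.le_of_mul_le_mul_right ?_ (pow_pos two_pos a : 0 < 2 ^ a)
    calc 8 * (2 ^ n₁ * h) * 2 ^ a = 8 * h * (2 ^ n₁ * 2 ^ a) := by ring
      _ = 8 * h * (128 * 2 ^ n) := by rw [hpow]
      _ ≤ 8 * (2 * (2 * 2 ^ a)) * (128 * 2 ^ n) := by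
        gcongr
        rw [pow_succ] at ha2
        omega
      _ = 4096 * 2 ^ n * 2 ^ a := by ring
  · intro s hs hsl k hk
    have hn0 : (0 : ℝ) < n := by exact_mod_cast (by omega : 0 < n)
    have hsn : s ^ 2 ≤ n := by
      have : (s : ℝ) ^ 2 ≤ n := le_trans (by gcongr) hsq
      exact_mod_cast this
    have hvol := pow_le_sum_choose hs hsn
    have hvol2 : ∑ j ∈ Finset.range (s + 1), n.choose j ≤ 2 ^ n := by
      rw [← Nat.sum_range_choose]
      refine Finset.sum_le_sum_of_subset (Finset.range_subset_range.2 ?_)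
      nlinarith
    set P : ℝ := 2 ^ n with hP
    set P₁ : ℝ := 2 ^ n₁ with hP₁
    have hP0 : 0 < P := by positivity
    have hPP : 128 * P ≤ P₁ * n := by
      have : 128 * 2 ^ n ≤ 2 ^ n₁ * n := by
        rw [← hpow]
        exact Nat.mul_le_mul_left _ ha1
      rw [hP, hP₁]
      exact_mod_cast this
    have hPn : P / n ≤ P₁ / 128 := by
      rw [div_le_iff₀ hn0]
      linarith
    set Q : ℝ := (n : ℝ) ^ (2 * (s / 8)) with hQ
    have hQ0 : 0 < Q := by positivity
    set W : ℝ := ∑ j ∈ Finset.range (s + 1), (n.choose j : ℝ) with hW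
    have hQW : n * Q ≤ W := by
      have : ((n ^ (2 * (s / 8) + 1) : ℕ) : ℝ) ≤
          ((∑ j ∈ Finset.range (s + 1), n.choose j : ℕ) : ℝ) := by exact_mod_cast hvol
      push_cast at this
      rw [pow_succ] at this
      linarith
    have hWP : W ≤ P := by
      rw [hW, hP]
      exact_mod_cast hvol2
    have hW0 : 0 < W := lt_of_lt_of_le (by positivity) hQW
    -- Allowing `s / 8` bad levels gives at most `Q = n ^ (2 * (s / 8))` signatures, a factor `n`
    -- below the binomial sum `W`.
    refine ⟨s / 8, ⌈P / W⌉₊, ?_, ?_, Nat.le_ceil _⟩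
    · have h1 : (s : ℝ) ≤ 8 * ((s / 8 : ℕ) + 1) := by
        have : s ≤ 8 * (s / 8 + 1) := by omega
        exact_mod_cast this
      have h2 : (s : ℝ) * P / (2 * n) = s * (P / n) / 2 := by field_simp
      have h3 : (24 * k : ℝ) ≤ ((s / 8 : ℕ) + 1) * P₁ := by
        have hP₁0 : 0 < P₁ := by positivity
        have : (s : ℝ) * (P / n) ≤ 8 * ((s / 8 : ℕ) + 1) * (P₁ / 128) := by gcongr
        rw [h2] at hk
        have h4 : (0 : ℝ) ≤ ((s / 8 : ℕ) + 1) * P₁ := by positivity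
        linarith
      rw [hP₁] at h3
      exact_mod_cast h3
    · have hceil : ((⌈P / W⌉₊ : ℕ) : ℝ) ≤ P / W + 1 := (Nat.ceil_lt_add_one (by positivity)).le
      have hcls : (((h * 2 ^ g + 1) ^ (s / 8) : ℕ) : ℝ) ≤ Q := by
        rw [hQ, pow_mul]
        exact_mod_cast Nat.pow_le_pow_left hbase (s / 8)
      have hPW : P / W * Q ≤ P / n := by
        rw [div_mul_eq_mul_div, div_le_div_iff₀ hW0 hn0]
        nlinarith
      have hQP : Q ≤ P / n := by
        rw [le_div_iff₀ hn0]
        linarith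
      have hPn0 : 0 < P / n := by positivity
      have : 2 * (((⌈P / W⌉₊ : ℕ) + 1 : ℝ) * (((h * 2 ^ g + 1) ^ (s / 8) : ℕ) : ℝ)) < P₁ := by
        calc _ ≤ 2 * ((P / W + 1 + 1) * Q) := by gcongr
          _ = 2 * (P / W * Q) + 4 * Q := by ring
          _ < P₁ := by linarith
      rw [hP₁] at this
      exact_mod_cast this

/-! ### The two families. -/

theorem exists_robust_family : ∃ (δ : ℕ) (C : ℝ), ∀ n : ℕ, 1 ≤ n →
    ∃ (M : ℕ) (G : Digraph (Fin M)), IsAcyclic G ∧ IndegreeLE G δ ∧ (M : ℝ) ≤ C * 2 ^ n ∧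
      ∀ s : ℕ, 1 ≤ s → (s : ℝ) ≤ Real.logb 2 n →
        IsDepthRobust G (s * 2 ^ n / (2 * n))
          (2 ^ n / ∑ j ∈ Finset.range (s + 1), (n.choose j : ℝ)) := by
  obtain ⟨δ, hδ⟩ := exists_tree 1 one_pos
  obtain ⟨n₀, hn₀⟩ := parameters_of_few_bad_levels 1 one_pos
  refine ⟨δ + 2 ^ (n₀ + 1), 4096, fun n hn => ?_⟩
  rcases lt_or_ge n n₀ with hlt | hge
  -- For the finitely many `n < n₀` the indegree of a tournament is absorbed into the constant.
  · refine ⟨2 ^ (n + 1), tournament _, tournament_isAcyclic _, fun v => ?_, ?_, ?_⟩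
    · refine (tournament_indegreeLE _ v).trans ?_
      have : 2 ^ (n + 1) ≤ δ + 2 ^ (n₀ + 1) :=
        (Nat.pow_le_pow_right two_pos (by omega)).trans (Nat.le_add_left _ _)
      exact_mod_cast this
    · push_cast
      rw [pow_succ]
      nlinarith [show (0 : ℝ) < 2 ^ n by positivity]
    · intro s hs hsl
      have hn1 : (1 : ℝ) ≤ n := by exact_mod_cast hn
      have hsn : (s : ℝ) ≤ n := by
        refine hsl.trans ((Real.logb_le_iff_le_rpow one_lt_two (by linarith)).2 ?_)
        rw [Real.rpow_natCast]
        exact_mod_cast (Nat.lt_two_pow_self (n := n)).le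
      have hsum : (2 : ℝ) ≤ ∑ j ∈ Finset.range (s + 1), (n.choose j : ℝ) := by
        calc (2 : ℝ) ≤ ∑ j ∈ Finset.range 2, (n.choose j : ℝ) := by
              simp only [Finset.sum_range_succ, Finset.sum_range_zero, Nat.choose_zero_right,
                Nat.choose_one_right]
              push_cast
              linarith
          _ ≤ _ := Finset.sum_le_sum_of_subset_of_nonneg
              (Finset.range_subset_range.2 (by omega)) (by intros; positivity)
      have h1 : (s : ℝ) * 2 ^ n / (2 * n) ≤ 2 ^ n / 2 := by
        rw [div_le_div_iff₀ (by positivity) two_pos]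
        nlinarith [show (0 : ℝ) < 2 ^ n by positivity]
      have h2 : (2 : ℝ) ^ n / ∑ j ∈ Finset.range (s + 1), (n.choose j : ℝ) ≤ 2 ^ n / 2 := by
        gcongr
      have h3 : (1 : ℝ) ≤ 2 ^ n := one_le_pow₀ one_le_two
      refine tournament_isDepthRobust ?_ (by positivity)
      push_cast
      rw [pow_succ]
      linarith
  · obtain ⟨n₁, hn₁, hsize, hpar⟩ := hn₀ n hge
    obtain ⟨M, G, hacyc, hdeg, -, hM, hpath⟩ := hδ n₁ hn₁
    refine ⟨M, G, hacyc, fun v => (hdeg v).trans ?_, ?_, ?_⟩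
    · exact_mod_cast Nat.le_add_right _ _
    · exact_mod_cast hM.trans hsize
    · intro s hs hsl S hS
      obtain ⟨s', d, h1, h2, h3⟩ := hpar s hs hsl S.card hS
      obtain ⟨k, hk, hp⟩ := hpath S s' d h1 h2
      exact ⟨k, h3.trans hk, hp⟩

theorem exists_extremely_robust_family : ∃ (δ : ℕ) (c C : ℝ), 0 < c ∧ ∀ n : ℕ, 1 ≤ n →
    ∃ (M : ℕ) (G : Digraph (Fin M)), IsAcyclic G ∧ IndegreeLE G δ ∧
      c * (n * 2 ^ n) ≤ (M : ℝ) ∧ (M : ℝ) ≤ C * (n * 2 ^ n) ∧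
      IsDepthRobust G (M * Real.logb 2 (Real.logb 2 M) / Real.logb 2 M)
        (M / Real.logb 2 M ^ (1 + Real.logb 2 (Real.logb 2 M))) := by
  obtain ⟨g, hg⟩ : ∃ g : ℕ, 3072 ≤ g := ⟨_, le_rfl⟩
  have hg0 : 0 < g := by omega
  have hg1 : (1 : ℝ) ≤ g := by exact_mod_cast hg0
  obtain ⟨δ, hδ⟩ := exists_tree g hg0
  obtain ⟨n₀, hn₀⟩ := parameters_of_few_deletions g hg
  refine ⟨δ + 16 * (n₀ * 2 ^ n₀), 1 / g, 16, by positivity, fun n hn => ?_⟩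
  have hn1 : (1 : ℝ) ≤ n := by exact_mod_cast hn
  have hpos : (0 : ℝ) < n * 2 ^ n := by positivity
  rcases lt_or_ge n n₀ with hlt | hge
  -- The factor 16 matches the upper constant and gives the 16 vertices that `tournament_robust`
  -- requires.
  · refine ⟨16 * (n * 2 ^ n), tournament _, tournament_isAcyclic _, fun v => ?_, ?_, ?_,
      tournament_robust ?_⟩
    · refine (tournament_indegreeLE _ v).trans ?_
      have : 16 * (n * 2 ^ n) ≤ δ + 16 * (n₀ * 2 ^ n₀) := by
        have := Nat.mul_le_mul hlt.le (Nat.pow_le_pow_right two_pos hlt.le)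
        omega
      exact_mod_cast this
    · push_cast
      have : 1 / (g : ℝ) ≤ 1 := by rw [div_le_one (by linarith)]; exact hg1
      nlinarith
    · push_cast
      exact le_rfl
    · have := Nat.mul_le_mul hn (Nat.one_le_two_pow (n := n))
      omega
  · obtain ⟨M, G, hacyc, hdeg, hM1, hM2, hpath⟩ := hδ n hn
    obtain ⟨hh1, -, hh3⟩ := height_bounds hg0 hn
    refine ⟨M, G, hacyc, fun v => (hdeg v).trans ?_, ?_, ?_, ?_⟩
    · exact_mod_cast Nat.le_add_right _ _
    · calc 1 / (g : ℝ) * (n * 2 ^ n) = 2 ^ n * (n / g) := by ring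
        _ ≤ 2 ^ n * ((n - 1) / g + 1 : ℕ) := by gcongr
        _ ≤ M := by exact_mod_cast hM1
    · have : M ≤ 16 * (n * 2 ^ n) := by
        have := Nat.mul_le_mul_left (2 ^ n) hh3
        nlinarith
      exact_mod_cast this
    · intro S hS
      obtain ⟨s, d, h1, h2, h3⟩ := hn₀ n hge M hM1 hM2 S.card hS
      obtain ⟨k, hk, hp⟩ := hpath S s d h1 h2
      exact ⟨k, h3.trans hk, hp⟩

end DepthRobust

theorem mainTheorem3 :
    (∃ (δ : ℕ) (C : ℝ) (M : ℕ → ℕ) (G : ∀ n : ℕ, Digraph (Fin (M n))),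
      ∀ n : ℕ, 1 ≤ n →
        DepthRobust.IsAcyclic (G n) ∧
        DepthRobust.IndegreeLE (G n) δ ∧
        (M n : ℝ) ≤ C * 2 ^ n ∧
        ∀ s : ℕ, 1 ≤ s → (s : ℝ) ≤ Real.logb 2 n →
          DepthRobust.IsEdgeDepthRobust (G n)
            (s * 2 ^ n / (2 * n)) (2 ^ n / ∑ j ∈ Finset.range (s + 1), (n.choose j : ℝ)) ∧
          DepthRobust.IsDepthRobust (G n)
            (s * 2 ^ n / (2 * n)) (2 ^ n / ∑ j ∈ Finset.range (s + 1), (n.choose j : ℝ))) ∧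
    (∃ (δ : ℕ) (c C : ℝ) (N' : ℕ → ℕ) (G' : ∀ n : ℕ, Digraph (Fin (N' n))),
      0 < c ∧
      ∀ n : ℕ, 1 ≤ n →
        DepthRobust.IsAcyclic (G' n) ∧
        DepthRobust.IndegreeLE (G' n) δ ∧
        c * (n * 2 ^ n) ≤ (N' n : ℝ) ∧ (N' n : ℝ) ≤ C * (n * 2 ^ n) ∧
        DepthRobust.IsDepthRobust (G' n)
          (N' n * Real.logb 2 (Real.logb 2 (N' n)) / Real.logb 2 (N' n))
          (N' n / Real.logb 2 (N' n) ^ (1 + Real.logb 2 (Real.logb 2 (N' n))))) := by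
  constructor
  · obtain ⟨δ, C, h⟩ := DepthRobust.exists_robust_family
    have h' : ∀ n : ℕ, ∃ (M : ℕ) (G : Digraph (Fin M)), 1 ≤ n → _ := fun n => by
      by_cases hn : 1 ≤ n
      · obtain ⟨M, G, hG⟩ := h n hn
        exact ⟨M, G, fun _ => hG⟩
      -- At `n = 0` nothing is claimed, and the empty graph serves as filler.
      · exact ⟨0, ⟨fun _ _ => False⟩, fun h => (hn h).elim⟩
    choose M G hG using h'
    refine ⟨δ, C, M, G, fun n hn => ?_⟩
    obtain ⟨h1, h2, h3, h4⟩ := hG n hn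
    exact ⟨h1, h2, h3, fun s hs hsl => ⟨(h4 s hs hsl).isEdgeDepthRobust, h4 s hs hsl⟩⟩
  · obtain ⟨δ, c, C, hc, h⟩ := DepthRobust.exists_extremely_robust_family
    have h' : ∀ n : ℕ, ∃ (M : ℕ) (G : Digraph (Fin M)), 1 ≤ n → _ := fun n => by
      by_cases hn : 1 ≤ n
      · obtain ⟨M, G, hG⟩ := h n hn
        exact ⟨M, G, fun _ => hG⟩
      · exact ⟨0, ⟨fun _ _ => False⟩, fun h => (hn h).elim⟩
    choose M G hG using h'
    exact ⟨δ, c, C, M, G, hc, hG⟩
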